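/- Let $p>1$ and $a,b,L>0$, write $x^\pm=\max\{\pm x,0\}$, and let $\mathbb N$ be the positive integers. A real number $\lambda$ is a Dirichlet eigenvalue of the asymmetric $p$-Laplacian $-\Delta^{a,b}_p$ on $(0,L)$, with eigenfunction $u$, if $u\in W^{1,p}_0(0,L)$, $u\neq 0$, and $$\int_0^L\bigl(a^p[(u')^+]^{p-1}-b^p[(u')^-]^{p-1}\bigr)v'\,dt=\lambda\int_0^L|u|^{p-2}u\,v\,dt\qquad\text{for all }v\in W^{1,p}_0(0,L).$$ Let $\Lambda^{a,b}_p(0,L)$ be the set of these eigenvalues and $\Lambda_p(0,L)=\Lambda^{1,1}_p(0,L)$ the Dirichlet spectrum of the usual $p$-Laplacian. Put $$\lambda_{1,p}(0,L)=(p-1)\Bigl(\frac{\pi_p}{L}\Bigr)^p,\qquad \pi_p=2\int_0^1(1-t^p)^{-1/p}\,dt .$$ Let $\varphi_p\in W^{1,p}_0(0,1)$ be the principal eigenfunction of the $p$-Laplacian on $(0,1)$, i.e. the unique positive eigenfunction of $-\Delta^{1,1}_p$ on $(0,1)$ for $\lambda_{1,p}(0,1)$ with $\|\varphi_p\|_{L^p(0,1)}=1$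 (it exists and is unique). With $t_0=\frac a{a+b}$ set, for $t\in[0,1)$, $$\varphi^{a,b,+}_p(t)=\begin{cases}\varphi_p\bigl(\tfrac t{2t_0}\bigr),&t<t_0,\\ \varphi_p\bigl(\tfrac{t+1-2t_0}{2(1-t_0)}\bigr),&t\ge t_0,\end{cases}\qquad \varphi^{a,b,-}_p(t)=\begin{cases}-\varphi_p\bigl(\tfrac t{2(1-t_0)}\bigr),&t<1-t_0,\\ -\varphi_p\bigl(\tfrac{t+2t_0-1}{2t_0}\bigr),&t\ge 1-t_0,\end{cases}$$ and let $\phi^{a,b}_p:\mathbb R\to\mathbb R$ be the $2$-periodic function with $\phi^{a,b}_p(t)=\varphi^{a,b,+}_p(t)$ for $t\in[0,1)$ and $\phi^{a,b}_p(t)=\varphi^{a,b,-}_p(t-1)$ for $t\in[1,2)$. Then: (I) $\displaystyle\Lambda^{a,b}_p(0,L)=\Bigl(\frac{a+b}2\Bigr)^p\Lambda_p(0,L)=\Bigl\{\lambda^{a,b}_{k,p}(0,L):=\Bigl(\frac{k(a+b)}2\Bigr)^p\lambda_{1,p}(0,L):\ k\in\mathbb N\Bigr\}.$ (II) For every $k\in\mathbb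 N$, a function $u$ is an eigenfunction of $-\Delta^{a,b}_p$ on $(0,L)$ associated to $\lambda^{a,b}_{k,p}(0,L)$ if and only if there is a constant $c>0$ such that either $u(t)=c\,\phi^{a,b}_p\bigl(\tfrac{kt}L\bigr)$ for (almost) all $t\in(0,L)$, or $u(t)=c\,\phi^{a,b}_p\bigl(\tfrac{kt}L-1\bigr)$ for (almost) all $t\in(0,L)$. -/

import Mathlib

open MeasureTheory Set
open scoped ContDiff ENNReal

noncomputable section

namespace AsymPLap

/-- `ψ ∈ C_c^∞(0, L)`. -/
def IsTestFunction (L : ℝ) (ψ : ℝ → ℝ) : Prop :=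
  ContDiff ℝ ∞ ψ ∧ HasCompactSupport ψ ∧ tsupport ψ ⊆ Ioo 0 L

/-- `g` is a weak derivative of `u` on `(0, L)`. -/
def HasWeakDeriv (L : ℝ) (u g : ℝ → ℝ) : Prop :=
  LocallyIntegrableOn u (Ioo 0 L) ∧ LocallyIntegrableOn g (Ioo 0 L) ∧
    ∀ ψ : ℝ → ℝ, IsTestFunction L ψ →
      ∫ t in Ioo 0 L, u t * deriv ψ t = -∫ t in Ioo 0 L, g t * ψ t

/-- `u ∈ L^p(0, L)`. -/
def MemLpInterval (p L : ℝ) (u : ℝ → ℝ) : Prop :=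
  MemLp u (ENNReal.ofReal p) (volume.restrict (Ioo 0 L))

/-- The `L^p(0, L)` norm of `u`. -/
def lpNormInterval (p L : ℝ) (u : ℝ → ℝ) : ℝ≥0∞ :=
  eLpNorm u (ENNReal.ofReal p) (volume.restrict (Ioo 0 L))

/-- `u ∈ W^{1,p}(0, L)` with weak derivative `u' = g`. -/
def MemW1p (p L : ℝ) (u g : ℝ → ℝ) : Prop :=
  MemLpInterval p L u ∧ MemLpInterval p L g ∧ HasWeakDeriv L u g

/-- `u ∈ W₀^{1,p}(0, L)` with weak derivative `u' = g`: `u` lies in the closure of `C_c^∞(0, L)`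
in `W^{1,p}(0, L)`. -/
def MemW01p (p L : ℝ) (u g : ℝ → ℝ) : Prop :=
  MemW1p p L u g ∧
    ∀ ε : ℝ≥0∞, 0 < ε → ∃ ψ : ℝ → ℝ, IsTestFunction L ψ ∧
      lpNormInterval p L (fun t => u t - ψ t) + lpNormInterval p L (fun t => g t - deriv ψ t) < ε

/-- The function `s ↦ a^p (s⁺)^{p-1} - b^p (s⁻)^{p-1}`, so that
`Δ^{a,b}_p u = (flux p a b u')'`. -/
def flux (p a b s : ℝ) : ℝ :=
  a ^ p * (max s 0) ^ (p - 1) - b ^ p * (max (-s) 0) ^ (p - 1)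

/-- `u ∈ W₀^{1,p}(0, L)` is a weak solution of `-Δ^{a,b}_p u = lam |u|^{p-2} u` in `(0, L)`,
`u(0) = u(L) = 0`. -/
def IsWeakSolution (p a b L lam : ℝ) (u : ℝ → ℝ) : Prop :=
  ∃ g : ℝ → ℝ, MemW01p p L u g ∧
    ∀ v h : ℝ → ℝ, MemW01p p L v h →
      ∫ t in Ioo 0 L, flux p a b (g t) * h t
        = lam * ∫ t in Ioo 0 L, |u t| ^ (p - 2) * u t * v t

/-- `u ∈ W₀^{1,p}(0, L)` is an eigenfunction of `-Δ^{a,b}_p` associated to `lam`: a nontrivial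
(that is, not almost everywhere zero) weak solution. -/
def IsEigenfunction (p a b L lam : ℝ) (u : ℝ → ℝ) : Prop :=
  IsWeakSolution p a b L lam u ∧ ¬ (∀ᵐ t ∂(volume.restrict (Ioo 0 L)), u t = 0)

/-- The Dirichlet spectrum `Λ^{a,b}_p(0, L)` of `-Δ^{a,b}_p`. -/
def dirichletSpectrum (p a b L : ℝ) : Set ℝ :=
  {lam | ∃ u : ℝ → ℝ, IsEigenfunction p a b L lam u}

/-- The Dirichlet spectrum `Λ_p(0, L)` of the `p`-Laplacian `-Δ_p = -Δ^{1,1}_p`. -/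
def pSpectrum (p L : ℝ) : Set ℝ := dirichletSpectrum p 1 1 L

/-- `π_p = 2 ∫₀¹ (1 - t^p)^{-1/p} dt`. -/
def piP (p : ℝ) : ℝ := 2 * ∫ t in (0 : ℝ)..1, (1 - t ^ p) ^ (-(1 / p))

/-- `λ_{1,p}(0, L) = (p - 1) (π_p / L)^p`. -/
def lambda1 (p L : ℝ) : ℝ := (p - 1) * (piP p / L) ^ p

/-- `φ` is (a representative of) the principal eigenfunction `φ_p` of the `p`-Laplacian on
`(0, 1)`: an eigenfunction associated to `λ_{1,p}(0, 1)`, positive, and of `L^p` norm one. -/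
def IsPrincipal (p : ℝ) (φ : ℝ → ℝ) : Prop :=
  IsEigenfunction p 1 1 1 (lambda1 p 1) φ ∧
    (∀ᵐ t ∂(volume.restrict (Ioo (0 : ℝ) 1)), 0 < φ t) ∧
    lpNormInterval p 1 φ = 1

/-- `t₀ = a / (a + b)`. -/
def tZero (a b : ℝ) : ℝ := a / (a + b)

/-- `φ^{a,b,+}_p` on `(0, 1)`, built from `φ = φ_p`. -/
def phiPlus (a b : ℝ) (φ : ℝ → ℝ) (t : ℝ) : ℝ :=
  if t < tZero a b then φ (t / (2 * tZero a b))
  else φ ((t + 1 - 2 * tZero a b) / (2 * (1 - tZero a b)))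

/-- `φ^{a,b,-}_p` on `(0, 1)`, built from `φ = φ_p`. -/
def phiMinus (a b : ℝ) (φ : ℝ → ℝ) (t : ℝ) : ℝ :=
  if t < 1 - tZero a b then -φ (t / (2 * (1 - tZero a b)))
  else -φ ((t + 2 * tZero a b - 1) / (2 * tZero a b))

/-- The 2-periodic function on `ℝ` equal to `φ^{a,b,+}_p(t)` on `[0, 1)` and to
`φ^{a,b,-}_p(t - 1)` on `[1, 2)`. Here `2 * Int.fract (t / 2)` is the representative of `t`
modulo 2 in `[0, 2)`. -/
def phiPer (a b : ℝ) (φ : ℝ → ℝ) (t : ℝ) : ℝ :=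
  if 2 * Int.fract (t / 2) < 1 then phiPlus a b φ (2 * Int.fract (t / 2))
  else phiMinus a b φ (2 * Int.fract (t / 2) - 1)

end AsymPLap

end

namespace AsymPLap

open Filter Topology Asymptotics

/-! The weak equation is a planar Hamiltonian system in disguise. Put `W = flux p a b U'`. Then `U'
= fluxInv W` and `W' = -lam |U|^(p-2) U`, with `U` vanishing at both ends. The du Bois-Reymond lemma
turns weak solutions into classical solutions of this system, and approximation by test functions
gives the converse (`isWeakSolution_iff`).

The system has a conserved energy, positive away from the origin when `lam > 0`. Its right-hand side
is generally not Lipschitz on the axes, but the energy identity makes up for this, and initial data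
other than the origin determine the solution (`IsSystemSol.eqOn`). A nontrivial Dirichlet solution
forces `lam > 0` (`IsSystemSol.lam_pos`) and then has `W 0 ≠ 0`.

One periodic solution is explicit (`isSystemSol_wave`). It consists of quarter arcs of the
generalized sine, stretched so that an increasing arc lasts `a / (a + b)` and a decreasing arc `b /
(a + b)`; its zeros are exactly the integers. By homogeneity, amplitude and frequency can be changed
freely. The frequency is determined by `lam`, the amplitude by `|W 0|`, and the phase, `0` or `-1`,
by the sign of `W 0`. Uniqueness identifies every eigenfunction with such a rescaled wave, and
vanishing at `L` forces the frequency times `L` to be an integer `k` (`isEigenfunction_iff`).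

The case `a = b = 1`, `k = 1` shows that the principal eigenfunction is the normalized symmetric
bump (`isPrincipal_iff`), so the function built from it in the statement is a positive multiple of
the wave almost everywhere (`phiPer_ae_eq`). -/

/-! ### Asymmetric powers -/

/-- The asymmetric power `A (x⁺)^α - B (x⁻)^α`. -/
noncomputable def apow (α A B x : ℝ) : ℝ := A * (max x 0) ^ α - B * (max (-x) 0) ^ α

/-- The primitive `(A (x⁺)^(α+1) + B (x⁻)^(α+1)) / (α + 1)` of `apow α A B`. -/
noncomputable def apowPrim (α A B x : ℝ) : ℝ :=
  (A * (max x 0) ^ (α + 1) + B * (max (-x) 0) ^ (α + 1)) / (α + 1)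

section apow

variable {α A B x : ℝ}

theorem apow_of_nonneg (hα : 0 < α) (hx : 0 ≤ x) : apow α A B x = A * x ^ α := by
  have : max (-x) 0 = 0 := max_eq_right (by linarith)
  simp [apow, max_eq_left hx, this, Real.zero_rpow hα.ne']

theorem apow_neg_eq : apow α A B (-x) = -apow α B A x := by
  simp [apow]

theorem apow_of_nonpos (hα : 0 < α) (hx : x ≤ 0) : apow α A B x = -(B * (-x) ^ α) := by
  rw [← neg_neg x, apow_neg_eq, apow_of_nonneg hα (by linarith), neg_neg]

theorem apow_zero (hα : 0 < α) : apow α A B 0 = 0 := by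
  simp [apow_of_nonneg hα le_rfl, Real.zero_rpow hα.ne']

theorem apow_pos (hα : 0 < α) (hA : 0 < A) (hx : 0 < x) : 0 < apow α A B x := by
  rw [apow_of_nonneg hα hx.le]; positivity

theorem apow_neg (hα : 0 < α) (hB : 0 < B) (hx : x < 0) : apow α A B x < 0 := by
  have : 0 < -x := by linarith
  rw [apow_of_nonpos hα hx.le]
  have : 0 < B * (-x) ^ α := by positivity
  linarith

theorem apow_ne_zero (hα : 0 < α) (hA : 0 < A) (hB : 0 < B) (hx : x ≠ 0) : apow α A B x ≠ 0 := by
  rcases lt_or_gt_of_ne hx with h | h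
  · exact (apow_neg hα hB h).ne
  · exact (apow_pos hα hA h).ne'

theorem apow_mul_self_nonneg (hα : 0 < α) (hA : 0 < A) (hB : 0 < B) : 0 ≤ apow α A B x * x := by
  rcases lt_trichotomy x 0 with h | h | h
  · exact (mul_pos_of_neg_of_neg (apow_neg hα hB h) h).le
  · simp [h]
  · exact (mul_pos (apow_pos hα hA h) h).le

theorem continuous_apow (hα : 0 < α) : Continuous (apow α A B) := by
  unfold apow
  exact (continuous_const.mul ((continuous_id.max continuous_const).rpow_const
    fun _ => Or.inr hα.le)).sub (continuous_const.mul
      ((continuous_neg.max continuous_const).rpow_const fun _ => Or.inr hα.le))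

theorem apow_pos_mul {c : ℝ} (hc : 0 < c) : apow α A B (c * x) = c ^ α * apow α A B x := by
  have h1 : max (c * x) 0 = c * max x 0 := by rw [mul_max_of_nonneg _ _ hc.le, mul_zero]
  have h2 : max (-(c * x)) 0 = c * max (-x) 0 := by
    rw [mul_max_of_nonneg _ _ hc.le, mul_zero, mul_neg]
  rw [apow, apow, h1, h2, Real.mul_rpow hc.le (le_max_right _ _),
    Real.mul_rpow hc.le (le_max_right _ _)]
  ring

/-- The inverse of an asymmetric power is again one, so both equations of the first-order system
fall under the same lemmas. -/
theorem apow_inv_apow (hα : 0 < α) (hA : 0 < A) (hB : 0 < B) :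
    apow α⁻¹ (A ^ (-α⁻¹)) (B ^ (-α⁻¹)) (apow α A B x) = x := by
  have key : ∀ {A B x : ℝ}, 0 < A → 0 ≤ x →
      apow α⁻¹ (A ^ (-α⁻¹)) (B ^ (-α⁻¹)) (apow α A B x) = x := by
    intro A B x hA hx
    rw [apow_of_nonneg hα hx, apow_of_nonneg (inv_pos.2 hα) (by positivity),
      Real.mul_rpow hA.le (by positivity), ← mul_assoc, ← Real.rpow_add hA, neg_add_cancel,
      Real.rpow_zero, one_mul, Real.rpow_rpow_inv hx hα.ne']
  rcases le_total 0 x with hx | hx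
  · exact key hA hx
  · rw [← neg_neg x, apow_neg_eq, apow_neg_eq, key hB (by linarith)]

theorem apow_apow_inv (hα : 0 < α) (hA : 0 < A) (hB : 0 < B) :
    apow α A B (apow α⁻¹ (A ^ (-α⁻¹)) (B ^ (-α⁻¹)) x) = x := by
  have h := apow_inv_apow (x := x) (inv_pos.2 hα) (Real.rpow_pos_of_pos hA (-α⁻¹))
    (Real.rpow_pos_of_pos hB (-α⁻¹))
  have e : ∀ {A : ℝ}, 0 < A → (A ^ (-α⁻¹)) ^ (-α) = A := by
    intro A hA
    rw [← Real.rpow_mul hA.le]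
    simp [hα.ne']
  rwa [inv_inv, e hA, e hB] at h

/-- The exponent exceeds one, which removes the corner at the origin: there the function is at most
`|y| ^ α * |y|`, which is `o(y)`. -/
theorem hasDerivAt_max_zero_rpow (hα : 0 < α) (x : ℝ) :
    HasDerivAt (fun y : ℝ => (max y 0) ^ (α + 1)) ((α + 1) * (max x 0) ^ α) x := by
  rcases lt_trichotomy x 0 with h | rfl | h
  · have : (fun y : ℝ => (max y 0) ^ (α + 1)) =ᶠ[𝓝 x] fun _ => 0 := by
      filter_upwards [Iio_mem_nhds h] with y hy
      rw [max_eq_right (le_of_lt hy), Real.zero_rpow (by linarith)]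
    rw [max_eq_right h.le, Real.zero_rpow hα.ne', mul_zero]
    exact (hasDerivAt_const x (0 : ℝ)).congr_of_eventuallyEq this
  · rw [max_self, Real.zero_rpow hα.ne', mul_zero]
    have h0 : ((max (0:ℝ) 0) ^ (α + 1)) = 0 := by rw [max_self, Real.zero_rpow (by linarith)]
    rw [hasDerivAt_iff_isLittleO_nhds_zero]
    simp only [zero_add, h0, sub_zero, smul_zero]
    rw [isLittleO_iff]
    intro c hc
    have ht : Tendsto (fun y : ℝ => |y| ^ α) (𝓝 0) (𝓝 0) := by
      have : ContinuousAt (fun y : ℝ => |y| ^ α) 0 :=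
        (continuous_abs.rpow_const fun _ => Or.inr hα.le).continuousAt
      simpa [ContinuousAt, Real.zero_rpow hα.ne'] using this
    filter_upwards [ht.eventually (Iio_mem_nhds hc)] with y hy
    have hm : max y 0 ≤ |y| := max_le (le_abs_self y) (abs_nonneg y)
    have hm0 : 0 ≤ max y 0 := le_max_right _ _
    rw [Real.norm_eq_abs, Real.norm_eq_abs, abs_of_nonneg (by positivity)]
    calc (max y 0) ^ (α + 1) ≤ |y| ^ (α + 1) := by gcongr
      _ = |y| ^ α * |y| := by
        rw [Real.rpow_add_one' (abs_nonneg y) (by linarith)]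
      _ ≤ c * |y| := by
        have : |y| ^ α ≤ c := le_of_lt hy
        gcongr
  · have : (fun y : ℝ => (max y 0) ^ (α + 1)) =ᶠ[𝓝 x] fun y => y ^ (α + 1) := by
      filter_upwards [Ioi_mem_nhds h] with y hy
      rw [max_eq_left (le_of_lt hy)]
    rw [max_eq_left h.le]
    have := (Real.hasDerivAt_rpow_const (x := x) (p := α + 1) (Or.inl h.ne'))
    rw [add_sub_cancel_right] at this
    exact this.congr_of_eventuallyEq ‹_›

theorem hasDerivAt_apowPrim (hα : 0 < α) (x : ℝ) :
    HasDerivAt (apowPrim α A B) (apow α A B x) x := by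
  have h1 := (hasDerivAt_max_zero_rpow hα x).const_mul A
  have h2 := ((hasDerivAt_max_zero_rpow hα (-x)).comp x (hasDerivAt_neg x)).const_mul B
  have h := (h1.add h2).div_const (α + 1)
  refine h.congr_deriv ?_
  unfold apow
  field_simp
  ring

theorem hasStrictDerivAt_apowPrim (hα : 0 < α) (x : ℝ) :
    HasStrictDerivAt (apowPrim α A B) (apow α A B x) x :=
  hasStrictDerivAt_of_hasDerivAt_of_continuousAt
    (Eventually.of_forall fun y => hasDerivAt_apowPrim hα y) (continuous_apow hα).continuousAt

theorem exists_hasStrictDerivAt_apow (hα : 0 < α) (hx : x ≠ 0) :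
    ∃ d, HasStrictDerivAt (apow α A B) d x := by
  have key : ∀ {A B x : ℝ}, 0 < x → ∃ d, HasStrictDerivAt (apow α A B) d x := by
    intro A B x h
    refine ⟨_, ((Real.hasStrictDerivAt_rpow_const_of_ne h.ne' α).const_mul
      A).congr_of_eventuallyEq ?_⟩
    filter_upwards [Ioi_mem_nhds h] with y hy
    rw [apow_of_nonneg hα (le_of_lt hy)]
  rcases lt_or_gt_of_ne hx with h | h
  · obtain ⟨d, hd⟩ := key (A := B) (B := A) (x := -x) (by linarith)
    refine ⟨_, (HasStrictDerivAt.scomp x hd (hasStrictDerivAt_neg x)).neg.congr_of_eventuallyEq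
      (Eventually.of_forall fun y => ?_)⟩
    simp [apow_neg_eq]
  · exact key h

theorem apowPrim_nonneg (hα : 0 < α) (hA : 0 < A) (hB : 0 < B) : 0 ≤ apowPrim α A B x := by
  unfold apowPrim
  positivity

theorem apowPrim_zero (hα : 0 < α) : apowPrim α A B 0 = 0 := by
  simp [apowPrim, Real.zero_rpow (by linarith : α + 1 ≠ 0)]

theorem apowPrim_pos (hα : 0 < α) (hA : 0 < A) (hB : 0 < B) (hx : x ≠ 0) :
    0 < apowPrim α A B x := by
  unfold apowPrim
  rcases lt_or_gt_of_ne hx with h | h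
  · have : 0 < max (-x) 0 := lt_max_of_lt_left (by linarith)
    positivity
  · have : 0 < max x 0 := lt_max_of_lt_left h
    positivity

theorem abs_rpow_mul_self (p x : ℝ) (hp : 1 < p) : |x| ^ (p - 2) * x = apow (p - 1) 1 1 x := by
  rcases lt_trichotomy x 0 with h | rfl | h
  · rw [apow_of_nonpos (by linarith) h.le, abs_of_neg h, one_mul,
      show p - 1 = p - 2 + 1 by ring, Real.rpow_add_one (by linarith)]
    ring
  · rw [apow_zero (by linarith), mul_zero]
  · rw [apow_of_nonneg (by linarith) h.le, abs_of_pos h, one_mul,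
      show p - 1 = p - 2 + 1 by ring, Real.rpow_add_one h.ne']

end apow

/-! ### Uniqueness for planar Hamiltonian systems with a separated Hamiltonian -/

/-- Only the equation for `u` is used; the energy identity replaces the one for `w`. Since `K' ≠ 0`
at the initial point, `|w₁ - w₂|` is bounded by a multiple of `|K w₁ - K w₂| = |J u₁ - J u₂|`, hence
of `|u₁ - u₂|`. Then `|(u₁ - u₂)'|` is bounded by a multiple of `|u₁ - u₂|`, and Grönwall applies.
The right-hand side of the omitted equation may therefore fail to be Lipschitz. -/
theorem eventually_eq_of_hamiltonian {φ K J : ℝ → ℝ} {u₁ u₂ w₁ w₂ : ℝ → ℝ} {t₀ b d e k : ℝ}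
    (hb : t₀ < b)
    (hu₁ : ∀ t ∈ Icc t₀ b, HasDerivAt u₁ (φ (w₁ t)) t)
    (hu₂ : ∀ t ∈ Icc t₀ b, HasDerivAt u₂ (φ (w₂ t)) t)
    (hw₁ : ContinuousAt w₁ t₀) (hw₂ : ContinuousAt w₂ t₀)
    (hE : ∀ t ∈ Icc t₀ b, K (w₁ t) + J (u₁ t) = K (w₂ t) + J (u₂ t))
    (hu : u₁ t₀ = u₂ t₀) (hw : w₁ t₀ = w₂ t₀)
    (hK : HasStrictDerivAt K k (w₁ t₀)) (hk : k ≠ 0)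
    (hφ : HasStrictDerivAt φ d (w₁ t₀)) (hJ : HasStrictDerivAt J e (u₁ t₀)) :
    ∀ᶠ t in 𝓝[>] t₀, u₁ t = u₂ t ∧ w₁ t = w₂ t := by
  have hmem : t₀ ∈ Icc t₀ b := ⟨le_rfl, hb.le⟩
  have tw : Tendsto (fun t => (w₁ t, w₂ t)) (𝓝[≥] t₀) (𝓝 (w₁ t₀, w₁ t₀)) := by
    have h2 := hw₂.tendsto
    rw [← hw] at h2
    exact (hw₁.tendsto.prodMk_nhds h2).mono_left nhdsWithin_le_nhds
  have tu : Tendsto (fun t => (u₁ t, u₂ t)) (𝓝[≥] t₀) (𝓝 (u₁ t₀, u₁ t₀)) := by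
    have h2 := (hu₂ t₀ hmem).continuousAt.tendsto
    rw [← hu] at h2
    exact ((hu₁ t₀ hmem).continuousAt.tendsto.prodMk_nhds h2).mono_left nhdsWithin_le_nhds
  have h1 : (fun t => φ (w₁ t) - φ (w₂ t)) =O[𝓝[≥] t₀] fun t => w₁ t - w₂ t :=
    hφ.isBigO_sub.comp_tendsto tw
  have h2 : (fun t => w₁ t - w₂ t) =O[𝓝[≥] t₀] fun t => K (w₁ t) - K (w₂ t) :=
    (hK.isTheta_sub hk).isBigO_symm.comp_tendsto tw
  have h3 : (fun t => J (u₁ t) - J (u₂ t)) =O[𝓝[≥] t₀] fun t => u₁ t - u₂ t :=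
    hJ.isBigO_sub.comp_tendsto tu
  have hIcc : ∀ᶠ t in 𝓝[≥] t₀, t ∈ Icc t₀ b := Icc_mem_nhdsGE hb
  have h4 : (fun t => K (w₁ t) - K (w₂ t)) =O[𝓝[≥] t₀] fun t => J (u₁ t) - J (u₂ t) := by
    refine IsBigO.of_bound 1 (hIcc.mono fun t ht => ?_)
    have := hE t ht
    rw [show K (w₁ t) - K (w₂ t) = -(J (u₁ t) - J (u₂ t)) by linarith, norm_neg, one_mul]
  have h5 := (h2.trans h4).trans h3
  -- `C` feeds Grönwall for `u₁ - u₂`; `C'` then recovers `w₁ = w₂` from `u₁ = u₂`.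
  obtain ⟨C, hC⟩ := (h1.trans h5).bound
  obtain ⟨C', hC'⟩ := h5.bound
  obtain ⟨c, hc, hsub⟩ := mem_nhdsGE_iff_exists_Icc_subset.1 (hC.and (hC'.and hIcc))
  have hz := eq_zero_of_abs_deriv_le_mul_abs_self_of_eq_zero_right
    (f := fun t => u₁ t - u₂ t) (f' := fun t => φ (w₁ t) - φ (w₂ t)) (K := C) (a := t₀) (b := c)
    (fun t ht => ((hu₁ t (hsub ht).2.2).sub
      (hu₂ t (hsub ht).2.2)).continuousAt.continuousWithinAt)
    (fun t ht => ((hu₁ t (hsub (Ico_subset_Icc_self ht)).2.2).sub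
      (hu₂ t (hsub (Ico_subset_Icc_self ht)).2.2)).hasDerivWithinAt)
    (by simp [hu]) (fun t ht => (hsub (Ico_subset_Icc_self ht)).1)
  filter_upwards [Ioc_mem_nhdsGT hc] with t ht
  have h6 := hz t (Ioc_subset_Icc_self ht)
  have h7 := (hsub (Ioc_subset_Icc_self ht)).2.1
  rw [h6, norm_zero, mul_zero] at h7
  exact ⟨sub_eq_zero.1 h6, sub_eq_zero.1 (norm_le_zero_iff.1 h7)⟩

/-! ### The first-order system -/

/-- The inverse of `flux p a b`. -/
noncomputable def fluxInv (p a b : ℝ) : ℝ → ℝ :=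
  apow (p - 1)⁻¹ ((a ^ p) ^ (-(p - 1)⁻¹)) ((b ^ p) ^ (-(p - 1)⁻¹))

/-- `(U, W)` solves `U' = fluxInv W`, `W' = -lam |U|^{p-2} U` at the points of `S`. -/
def IsSystemSol (p a b lam : ℝ) (U W : ℝ → ℝ) (S : Set ℝ) : Prop :=
  ∀ t ∈ S, HasDerivAt U (fluxInv p a b (W t)) t ∧
    HasDerivAt W (-(lam * apow (p - 1) 1 1 (U t))) t

/-- The energy of the system. -/
noncomputable def energy (p a b lam u w : ℝ) : ℝ :=
  apowPrim (p - 1)⁻¹ ((a ^ p) ^ (-(p - 1)⁻¹)) ((b ^ p) ^ (-(p - 1)⁻¹)) w +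
    lam * apowPrim (p - 1) 1 1 u

section system

variable {p a b lam L : ℝ} {U W U₁ U₂ W₁ W₂ : ℝ → ℝ}

theorem flux_eq_apow : flux p a b = apow (p - 1) (a ^ p) (b ^ p) := rfl

theorem continuous_flux (hp : 1 < p) : Continuous (flux p a b) :=
  continuous_apow (by linarith)

theorem continuous_fluxInv (hp : 1 < p) : Continuous (fluxInv p a b) :=
  continuous_apow (inv_pos.2 (by linarith))

theorem flux_fluxInv (hp : 1 < p) (ha : 0 < a) (hb : 0 < b) (w : ℝ) :
    flux p a b (fluxInv p a b w) = w :=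
  apow_apow_inv (by linarith) (by positivity) (by positivity)

theorem fluxInv_flux (hp : 1 < p) (ha : 0 < a) (hb : 0 < b) (s : ℝ) :
    fluxInv p a b (flux p a b s) = s :=
  apow_inv_apow (by linarith) (by positivity) (by positivity)

theorem fluxInv_pos_mul {c w : ℝ} (hp : 1 < p) (hc : 0 < c) :
    fluxInv p a b (c ^ (p - 1) * w) = c * fluxInv p a b w := by
  rw [fluxInv, apow_pos_mul (by positivity), Real.rpow_rpow_inv hc.le (by linarith)]

theorem fluxInv_zero (hp : 1 < p) : fluxInv p a b 0 = 0 := apow_zero (inv_pos.2 (by linarith))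

theorem IsSystemSol.energy_eq (hp : 1 < p) (h : IsSystemSol p a b lam U W (Icc 0 L))
    {t : ℝ} (ht : t ∈ Icc 0 L) :
    energy p a b lam (U t) (W t) = energy p a b lam (U 0) (W 0) := by
  have hr : 0 < (p - 1)⁻¹ := inv_pos.2 (by linarith)
  have hd : ∀ t ∈ Icc 0 L, HasDerivAt (fun t => energy p a b lam (U t) (W t)) 0 t := by
    intro t ht
    obtain ⟨hU, hW⟩ := h t ht
    have h1 := ((hasDerivAt_apowPrim hr (A := (a ^ p) ^ (-(p - 1)⁻¹))
      (B := (b ^ p) ^ (-(p - 1)⁻¹)) (W t)).comp t hW).add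
      (((hasDerivAt_apowPrim (α := p - 1) (A := 1) (B := 1) (by linarith) (U t)).comp t
        hU).const_mul lam)
    refine h1.congr_deriv ?_
    simp only [fluxInv]
    ring
  exact constant_of_has_deriv_right_zero
    (fun t ht => (hd t ht).continuousAt.continuousWithinAt)
    (fun t ht => (hd t (Ico_subset_Icc_self ht)).hasDerivWithinAt) t ht

theorem energy_pos (hp : 1 < p) (ha : 0 < a) (hb : 0 < b) (hlam : 0 < lam) {u w : ℝ}
    (h : u ≠ 0 ∨ w ≠ 0) : 0 < energy p a b lam u w := by
  have hr : 0 < (p - 1)⁻¹ := inv_pos.2 (by linarith)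
  have hA : 0 < (a ^ p) ^ (-(p - 1)⁻¹) := by positivity
  have hB : 0 < (b ^ p) ^ (-(p - 1)⁻¹) := by positivity
  have hp' : 0 < p - 1 := by linarith
  rcases h with h | h
  · exact add_pos_of_nonneg_of_pos (apowPrim_nonneg hr hA hB)
      (mul_pos hlam (apowPrim_pos hp' one_pos one_pos h))
  · exact add_pos_of_pos_of_nonneg (apowPrim_pos hr hA hB h)
      (mul_nonneg hlam.le (apowPrim_nonneg hp' one_pos one_pos))

theorem energy_zero (hp : 1 < p) : energy p a b lam 0 0 = 0 := by
  rw [energy, apowPrim_zero (inv_pos.2 (by linarith)), apowPrim_zero (by linarith)]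
  simp

/-- Continuous induction: the set of agreement is closed, and local uniqueness extends it to the
right. Conservation of the positive energy keeps the trajectory off the origin, so at each time at
least one coordinate is nonzero and can serve as the `w` of `eventually_eq_of_hamiltonian`. -/
theorem IsSystemSol.eqOn (hp : 1 < p) (ha : 0 < a) (hb : 0 < b) (hlam : 0 < lam)
    (h₁ : IsSystemSol p a b lam U₁ W₁ (Icc 0 L)) (h₂ : IsSystemSol p a b lam U₂ W₂ (Icc 0 L))
    (hU : U₁ 0 = U₂ 0) (hW : W₁ 0 = W₂ 0) (hne : U₁ 0 ≠ 0 ∨ W₁ 0 ≠ 0) :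
    EqOn U₁ U₂ (Icc 0 L) := by
  have hr : 0 < (p - 1)⁻¹ := inv_pos.2 (by linarith)
  have hA : 0 < (a ^ p) ^ (-(p - 1)⁻¹) := by positivity
  have hB : 0 < (b ^ p) ^ (-(p - 1)⁻¹) := by positivity
  have hp' : 0 < p - 1 := by linarith
  set s : Set ℝ := {t | U₁ t = U₂ t ∧ W₁ t = W₂ t} with hs
  have hE : ∀ t ∈ Icc 0 L, energy p a b lam (U₁ t) (W₁ t) = energy p a b lam (U₂ t) (W₂ t) := by
    intro t ht
    rw [h₁.energy_eq hp ht, h₂.energy_eq hp ht, hU, hW]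
  have hclosed : IsClosed (s ∩ Icc 0 L) := by
    have hc : ContinuousOn (fun t => (U₁ t - U₂ t, W₁ t - W₂ t)) (Icc 0 L) := fun t ht =>
      (((h₁ t ht).1.continuousAt.sub (h₂ t ht).1.continuousAt).prodMk
        ((h₁ t ht).2.continuousAt.sub (h₂ t ht).2.continuousAt)).continuousWithinAt
    have := hc.preimage_isClosed_of_isClosed isClosed_Icc (isClosed_singleton (x := (0, 0)))
    convert this using 1
    ext t
    simp [hs, sub_eq_zero, and_comm]
  have hsub : Icc 0 L ⊆ s := by
    refine hclosed.Icc_subset_of_forall_mem_nhdsWithin ⟨hU, hW⟩ ?_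
    rintro t ⟨⟨htU, htW⟩, ht⟩
    have hsubI : Icc t L ⊆ Icc 0 L := Icc_subset_Icc_left ht.1
    have hmem : t ∈ Icc 0 L := Ico_subset_Icc_self ht
    -- At a turning point of `U` the two coordinates exchange roles.
    by_cases hWt : W₁ t = 0
    · have hUt : U₁ t ≠ 0 := by
        intro hUt
        have e1 := h₁.energy_eq hp hmem
        rw [hUt, hWt, energy_zero hp] at e1
        exact (energy_pos hp ha hb hlam hne).ne e1
      obtain ⟨d, hd⟩ := exists_hasStrictDerivAt_apow (α := p - 1) (A := 1) (B := 1) hp' hUt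
      have := eventually_eq_of_hamiltonian (u₁ := W₁) (u₂ := W₂) (w₁ := U₁) (w₂ := U₂)
        (φ := fun x => -(lam * apow (p - 1) 1 1 x))
        (K := fun x => lam * apowPrim (p - 1) 1 1 x)
        (J := apowPrim (p - 1)⁻¹ ((a ^ p) ^ (-(p - 1)⁻¹)) ((b ^ p) ^ (-(p - 1)⁻¹)))
        ht.2 (fun x hx => (h₁ x (hsubI hx)).2) (fun x hx => (h₂ x (hsubI hx)).2)
        (h₁ t hmem).1.continuousAt (h₂ t hmem).1.continuousAt
        (fun x hx => by
          have := hE x (hsubI hx)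
          simp only [energy] at this
          linarith)
        htW htU ((hasStrictDerivAt_apowPrim hp' _).const_mul lam)
        (mul_ne_zero hlam.ne' (apow_ne_zero hp' one_pos one_pos hUt))
        (hd.const_mul lam).neg (hasStrictDerivAt_apowPrim hr _)
      exact this.mono fun x hx => ⟨hx.2, hx.1⟩
    · obtain ⟨d, hd⟩ := exists_hasStrictDerivAt_apow (A := (a ^ p) ^ (-(p - 1)⁻¹))
        (B := (b ^ p) ^ (-(p - 1)⁻¹)) hr hWt
      exact eventually_eq_of_hamiltonian (u₁ := U₁) (u₂ := U₂) (w₁ := W₁) (w₂ := W₂)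
        (φ := fluxInv p a b)
        (J := fun x => lam * apowPrim (p - 1) 1 1 x)
        (K := apowPrim (p - 1)⁻¹ ((a ^ p) ^ (-(p - 1)⁻¹)) ((b ^ p) ^ (-(p - 1)⁻¹)))
        ht.2 (fun x hx => (h₁ x (hsubI hx)).1) (fun x hx => (h₂ x (hsubI hx)).1)
        (h₁ t hmem).2.continuousAt (h₂ t hmem).2.continuousAt
        (fun x hx => hE x (hsubI hx))
        htU htW (hasStrictDerivAt_apowPrim hr _) (apow_ne_zero hr hA hB hWt)
        hd ((hasStrictDerivAt_apowPrim hp' _).const_mul lam)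
  exact fun t ht => (hsub ht).1

/-- A nontrivial solution vanishing at both ends forces a positive parameter. -/
theorem IsSystemSol.lam_pos (hp : 1 < p) (ha : 0 < a) (hb : 0 < b)
    (h : IsSystemSol p a b lam U W (Icc 0 L)) (h0 : U 0 = 0) (hL : U L = 0)
    (hne : ∃ t ∈ Icc 0 L, U t ≠ 0) : 0 < lam := by
  by_contra! hlam
  obtain ⟨t₁, ht₁, hUt₁⟩ := hne
  have hr : 0 < (p - 1)⁻¹ := inv_pos.2 (by linarith)
  have hA : 0 < (a ^ p) ^ (-(p - 1)⁻¹) := by positivity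
  have hB : 0 < (b ^ p) ^ (-(p - 1)⁻¹) := by positivity
  have hp' : 0 < p - 1 := by linarith
  -- For `lam ≤ 0` both terms of `(U W)'` are nonnegative. As `U W` vanishes at both ends it is
  -- identically zero, so `W = 0` in the interior and `U` is constant.
  have hd : ∀ t ∈ Icc 0 L, HasDerivAt (fun t => U t * W t)
      (fluxInv p a b (W t) * W t + U t * -(lam * apow (p - 1) 1 1 (U t))) t := fun t ht =>
    (h t ht).1.mul (h t ht).2
  have hnn : ∀ t, 0 ≤ U t * -(lam * apow (p - 1) 1 1 (U t)) := by
    intro t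
    have := apow_mul_self_nonneg (x := U t) hp' one_pos one_pos
    nlinarith
  have hnn' : ∀ t, 0 ≤ fluxInv p a b (W t) * W t := fun t => apow_mul_self_nonneg hr hA hB
  have hmono : MonotoneOn (fun t => U t * W t) (Icc 0 L) := by
    refine monotoneOn_of_deriv_nonneg (convex_Icc 0 L)
      (fun t ht => (hd t ht).continuousAt.continuousWithinAt)
      (fun t ht => (hd t (interior_subset ht)).differentiableAt.differentiableWithinAt)
      fun t ht => ?_
    rw [(hd t (interior_subset ht)).deriv]
    exact add_nonneg (hnn' t) (hnn t)
  have hL0 : 0 ≤ L := ht₁.1.trans ht₁.2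
  have hz : ∀ t ∈ Icc 0 L, U t * W t = 0 := by
    intro t ht
    have e1 := hmono (left_mem_Icc.2 hL0) ht ht.1
    have e2 := hmono ht (right_mem_Icc.2 hL0) ht.2
    simp only [h0, hL, zero_mul] at e1 e2
    exact le_antisymm e2 e1
  have hder : ∀ t ∈ Ioo 0 L, W t = 0 := by
    intro t ht
    have e1 : HasDerivAt (fun t => U t * W t) 0 t :=
      (hasDerivAt_const t (0 : ℝ)).congr_of_eventuallyEq
        (Filter.mem_of_superset (Icc_mem_nhds ht.1 ht.2) hz)
    have e2 := e1.unique (hd t (Ioo_subset_Icc_self ht))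
    have e3 : fluxInv p a b (W t) * W t = 0 := by
      have := hnn t; have := hnn' t; linarith
    by_contra hW
    exact mul_ne_zero (apow_ne_zero hr hA hB hW) hW e3
  refine hUt₁ ?_
  rw [← h0]
  refine constant_of_has_deriv_right_zero
    (fun t ht => (h t ht).1.continuousAt.continuousWithinAt) (fun t ht => ?_) t₁ ht₁
  have h1 := (h t (Ico_subset_Icc_self ht)).1
  -- The left endpoint is included here, so the value is obtained as a limit from the right.
  have hWt : W t = 0 := by
    have hc : Tendsto W (𝓝[>] t) (𝓝 (W t)) :=
      (h t (Ico_subset_Icc_self ht)).2.continuousAt.tendsto.mono_left nhdsWithin_le_nhds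
    have hc' : Tendsto W (𝓝[>] t) (𝓝 0) := by
      refine tendsto_const_nhds.congr' ?_
      filter_upwards [Ioo_mem_nhdsGT ht.2] with x hx
      exact (hder x ⟨ht.1.trans_lt hx.1, hx.2⟩).symm
    exact tendsto_nhds_unique hc hc'
  rw [hWt, fluxInv_zero hp] at h1
  exact h1.hasDerivWithinAt

end system

/-! ### Test functions -/

section testFunction

variable {L : ℝ} {ψ χ : ℝ → ℝ}

theorem setIntegral_Ioo_eq (hL : 0 < L) (f : ℝ → ℝ) :
    ∫ t in Ioo 0 L, f t = ∫ t in (0 : ℝ)..L, f t := by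
  rw [intervalIntegral.integral_of_le hL.le, integral_Ioc_eq_integral_Ioo]

theorem IsTestFunction.eq_zero (h : IsTestFunction L ψ) {t : ℝ} (ht : t ∉ Ioo 0 L) : ψ t = 0 :=
  image_eq_zero_of_notMem_tsupport fun h' => ht (h.2.2 h')

theorem IsTestFunction.hasDerivAt (h : IsTestFunction L ψ) (t : ℝ) :
    HasDerivAt ψ (deriv ψ t) t :=
  (h.1.differentiable (by simp) t).hasDerivAt

theorem IsTestFunction.derivative (h : IsTestFunction L ψ) : IsTestFunction L (deriv ψ) :=
  ⟨(contDiff_infty_iff_deriv.1 h.1).2, h.2.1.deriv, (tsupport_deriv_subset).trans h.2.2⟩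

theorem IsTestFunction.sub_const_mul (h : IsTestFunction L ψ) (h' : IsTestFunction L χ) (c : ℝ) :
    IsTestFunction L (fun t => ψ t - c * χ t) := by
  have hs : tsupport (fun t => c * χ t) ⊆ tsupport χ := closure_mono fun t ht => by
    simp only [Function.mem_support] at ht ⊢
    exact right_ne_zero_of_mul ht
  refine ⟨h.1.sub (contDiff_const.mul h'.1), h.2.1.sub (h'.2.1.mul_left), ?_⟩
  exact (tsupport_sub ψ (fun t => c * χ t)).trans (union_subset h.2.2 (hs.trans h'.2.2))

theorem IsTestFunction.integral_deriv (h : IsTestFunction L ψ) (t : ℝ) :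
    ∫ s in (0 : ℝ)..t, deriv ψ s = ψ t := by
  rw [intervalIntegral.integral_eq_sub_of_hasDerivAt (fun s _ => h.hasDerivAt s)
    (h.derivative.1.continuous.intervalIntegrable _ _), h.eq_zero (t := 0) (by simp), sub_zero]

theorem IsTestFunction.integral_mul_deriv (hL : 0 < L) (h : IsTestFunction L ψ) {F F' : ℝ → ℝ}
    (hF : ∀ t ∈ Icc 0 L, HasDerivAt F (F' t) t) (hF' : ContinuousOn F' (Icc 0 L)) :
    ∫ t in Ioo 0 L, F t * deriv ψ t = -∫ t in Ioo 0 L, F' t * ψ t := by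
  rw [setIntegral_Ioo_eq hL, setIntegral_Ioo_eq hL,
    intervalIntegral.integral_mul_deriv_eq_deriv_mul (u' := F')
      (fun t ht => hF t (by rwa [uIcc_of_le hL.le] at ht)) (fun t _ => h.hasDerivAt t)
      (ContinuousOn.intervalIntegrable (by rwa [uIcc_of_le hL.le]))
      (h.derivative.1.continuous.intervalIntegrable _ _),
    h.eq_zero (t := 0) (by simp), h.eq_zero (t := L) (by simp)]
  simp

theorem exists_Icc_of_isCompact (hL : 0 < L) {K : Set ℝ} (hK : IsCompact K) (hKL : K ⊆ Ioo 0 L) :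
    ∃ c d, 0 < c ∧ d < L ∧ K ⊆ Icc c d := by
  rcases K.eq_empty_or_nonempty with rfl | hne
  · exact ⟨1, 0, one_pos, hL, empty_subset _⟩
  · obtain ⟨c, hc⟩ := hK.exists_isLeast hne
    obtain ⟨d, hd⟩ := hK.exists_isGreatest hne
    exact ⟨c, d, (hKL hc.1).1, (hKL hd.1).2, fun x hx => ⟨hc.2 hx, hd.2 hx⟩⟩

/-- Zero mean is what makes the primitive vanish to the right of the support of `χ` as well as to
the left. -/
theorem IsTestFunction.exists_primitive (hL : 0 < L) (h : IsTestFunction L χ)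
    (h0 : ∫ t in Ioo 0 L, χ t = 0) :
    IsTestFunction L (fun t => ∫ s in (0 : ℝ)..t, χ s) ∧
      deriv (fun t => ∫ s in (0 : ℝ)..t, χ s) = χ := by
  have hc := h.1.continuous
  have hd : ∀ t, HasDerivAt (fun t => ∫ s in (0 : ℝ)..t, χ s) (χ t) t := fun t =>
    hc.integral_hasStrictDerivAt 0 t |>.hasDerivAt
  have hder : deriv (fun t => ∫ s in (0 : ℝ)..t, χ s) = χ := funext fun t => (hd t).deriv
  obtain ⟨c, d, hc0, hdL, hK⟩ := exists_Icc_of_isCompact hL h.2.1 h.2.2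
  have hz : ∀ s, s ∉ Icc c d → χ s = 0 := fun s hs =>
    image_eq_zero_of_notMem_tsupport fun h' => hs (hK h')
  have hsupp : Function.support (fun t => ∫ s in (0 : ℝ)..t, χ s) ⊆ Icc c d := by
    intro t ht
    by_contra hn
    apply ht
    rcases lt_or_ge t c with h1 | h1
    · refine intervalIntegral.integral_zero_ae (Eventually.of_forall fun s hs => hz s ?_)
      intro hs'
      have : s ≤ max 0 t := hs.2
      have := max_lt hc0 h1
      linarith [hs'.1]
    · have h2 : d < t := by
        by_contra! h2
        exact hn ⟨h1, h2⟩
      rw [setIntegral_Ioo_eq hL] at h0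
      beta_reduce
      rw [← intervalIntegral.integral_add_adjacent_intervals
        (hc.intervalIntegrable 0 L) (hc.intervalIntegrable L t), h0, zero_add]
      refine intervalIntegral.integral_zero_ae (Eventually.of_forall fun s hs => hz s ?_)
      intro hs'
      have : min L t < s := hs.1
      have := lt_min hdL h2
      linarith [hs'.2]
  have hts : tsupport (fun t => ∫ s in (0 : ℝ)..t, χ s) ⊆ Icc c d :=
    closure_minimal hsupp isClosed_Icc
  refine ⟨⟨contDiff_infty_iff_deriv.2 ⟨fun t => (hd t).differentiableAt, by rw [hder]; exact h.1⟩,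
    HasCompactSupport.of_support_subset_isCompact isCompact_Icc hsupp,
    hts.trans fun x hx => ⟨hc0.trans_le hx.1, hx.2.trans_lt hdL⟩⟩, hder⟩

theorem exists_isTestFunction_integral_eq_one (hL : 0 < L) :
    ∃ η, IsTestFunction L η ∧ ∫ t in Ioo 0 L, η t = 1 := by
  let f : ContDiffBump (L / 2) := ⟨L / 8, L / 4, by positivity, by linarith⟩
  have hts : tsupport (f.normed volume) ⊆ Ioo 0 L := by
    rw [f.tsupport_normed_eq, Real.closedBall_eq_Icc]
    intro x hx
    have h1 : L / 2 - L / 4 ≤ x := hx.1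
    have h2 : x ≤ L / 2 + L / 4 := hx.2
    exact ⟨by linarith, by linarith⟩
  refine ⟨f.normed volume, ⟨f.contDiff_normed, f.hasCompactSupport_normed, hts⟩, ?_⟩
  rw [setIntegral_eq_integral_of_forall_compl_eq_zero, f.integral_normed]
  intro x hx
  exact image_eq_zero_of_notMem_tsupport fun h' => hx (hts h')

theorem IsTestFunction.integrable_mul (h : IsTestFunction L ψ) {G : ℝ → ℝ}
    (hG : IntegrableOn G (Ioo 0 L)) : IntegrableOn (fun t => G t * ψ t) (Ioo 0 L) := by
  obtain ⟨C, hC⟩ := h.1.continuous.bounded_above_of_compact_support h.2.1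
  exact hG.mul_bdd (c := C) h.1.continuous.aestronglyMeasurable (Eventually.of_forall hC)

/-- The du Bois-Reymond lemma. -/
theorem exists_ae_eq_const (hL : 0 < L) {G : ℝ → ℝ} (hG : IntegrableOn G (Ioo 0 L))
    (h : ∀ ψ, IsTestFunction L ψ → ∫ t in Ioo 0 L, G t * deriv ψ t = 0) :
    ∃ c, ∀ᵐ t ∂(volume.restrict (Ioo 0 L)), G t = c := by
  obtain ⟨η, hη, hη1⟩ := exists_isTestFunction_integral_eq_one hL
  set c := ∫ t in Ioo 0 L, G t * η t with hc
  refine ⟨c, ?_⟩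
  have hGc : IntegrableOn (fun t => G t - c) (Ioo 0 L) :=
    hG.sub (integrableOn_const (by simp))
  have key : ∀ᵐ t, t ∈ Ioo 0 L → G t - c = 0 := by
    refine isOpen_Ioo.ae_eq_zero_of_integral_contDiff_smul_eq_zero hGc.locallyIntegrableOn ?_
    intro χ h1 h2 h3
    have hχ : IsTestFunction L χ := ⟨h1, h2, h3⟩
    have hχi : ∀ {χ : ℝ → ℝ}, IsTestFunction L χ → IntegrableOn χ (Ioo 0 L) := fun hχ =>
      (hχ.1.continuous.integrable_of_hasCompactSupport hχ.2.1).integrableOn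
    -- Subtracting `m * η` gives zero mean, so `χ - m η` is the derivative of a test function and is
    -- annihilated by `G`. With `c = ∫ G η` this says `∫ (G - c) χ = 0`.
    set m := ∫ t in Ioo 0 L, χ t with hm
    have ht := hχ.sub_const_mul hη m
    have h0 : ∫ t in Ioo 0 L, (χ t - m * η t) = 0 := by
      rw [integral_sub (hχi hχ) ((hχi hη).const_mul m), integral_const_mul, hη1]
      simp [hm]
    obtain ⟨hp1, hp2⟩ := ht.exists_primitive hL h0
    have h4 := h _ hp1
    rw [hp2] at h4
    have h5 : ∫ t in Ioo 0 L, G t * (χ t - m * η t)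
        = (∫ t in Ioo 0 L, G t * χ t) - m * c := by
      rw [hc, ← integral_const_mul, ← integral_sub (hχ.integrable_mul hG)
        ((hη.integrable_mul hG).const_mul m)]
      congr 1 with t
      ring
    have h6 : ∫ t in Ioo 0 L, χ t * (G t - c) = (∫ t in Ioo 0 L, G t * χ t) - c * m := by
      rw [hm, ← integral_const_mul, ← integral_sub (hχ.integrable_mul hG)
        ((hχi hχ).const_mul c)]
      congr 1 with t
      ring
    rw [← setIntegral_eq_integral_of_forall_compl_eq_zero (s := Ioo 0 L)]
    · simp only [smul_eq_mul]
      rw [h6]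
      linarith [h5.symm.trans h4]
    · intro x hx
      rw [hχ.eq_zero hx, zero_smul]
  rw [ae_restrict_iff' measurableSet_Ioo]
  exact key.mono fun t ht h => sub_eq_zero.1 (ht h)

end testFunction

/-! ### The space `W₀^{1,p}(0, L)` -/

section sobolev

variable {p L : ℝ} {u g v h ψ : ℝ → ℝ}

theorem one_le_ofReal (hp : 1 < p) : 1 ≤ ENNReal.ofReal p := by
  simpa using ENNReal.ofReal_le_ofReal hp.le

theorem MemLpInterval.integrableOn (hp : 1 < p) (hu : MemLpInterval p L u) :
    IntegrableOn u (Ioo 0 L) :=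
  MemLp.integrable (one_le_ofReal hp) hu

theorem IsTestFunction.memLpInterval (h : IsTestFunction L ψ) : MemLpInterval p L ψ :=
  (h.1.continuous.memLp_of_hasCompactSupport h.2.1).restrict _

theorem IsTestFunction.memW01p (hL : 0 < L) (h : IsTestFunction L ψ) :
    MemW01p p L ψ (deriv ψ) := by
  refine ⟨⟨h.memLpInterval, h.derivative.memLpInterval,
    h.1.continuous.locallyIntegrable.locallyIntegrableOn _,
    h.derivative.1.continuous.locallyIntegrable.locallyIntegrableOn _, fun χ hχ => ?_⟩,
    fun ε hε => ⟨ψ, h, ?_⟩⟩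
  · exact hχ.integral_mul_deriv hL (fun t _ => h.hasDerivAt t) h.derivative.1.continuous.continuousOn
  · simpa [lpNormInterval] using hε

theorem lpNormInterval_one_le (hp : 1 < p) (hL : 0 < L)
    (hu : AEStronglyMeasurable u (volume.restrict (Ioo 0 L))) :
    lpNormInterval 1 L u ≤ lpNormInterval p L u * ENNReal.ofReal (L ^ (1 - 1 / p)) := by
  have h := eLpNorm_le_eLpNorm_mul_rpow_measure_univ (μ := volume.restrict (Ioo 0 L))
    (ENNReal.ofReal_le_ofReal hp.le) hu
  refine h.trans (le_of_eq ?_)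
  rw [lpNormInterval, ENNReal.toReal_ofReal zero_le_one, ENNReal.toReal_ofReal (by linarith)]
  simp only [MeasurableSet.univ, Measure.restrict_apply, univ_inter, Real.volume_Ioo, sub_zero]
  rw [ENNReal.ofReal_rpow_of_pos hL]
  norm_num

theorem integral_abs_eq (hu : AEStronglyMeasurable u (volume.restrict (Ioo 0 L))) :
    ∫ t in Ioo 0 L, |u t| = (lpNormInterval 1 L u).toReal := by
  rw [lpNormInterval, ENNReal.ofReal_one, eLpNorm_one_eq_lintegral_enorm,
    ← integral_norm_eq_lintegral_enorm hu]
  rfl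

/-- Closeness in `L¹` is enough, because the approximants are later paired only with bounded
functions. -/
theorem MemW01p.exists_approx (hp : 1 < p) (hL : 0 < L) (h : MemW01p p L u g) {ε : ℝ}
    (hε : 0 < ε) : ∃ ψ, IsTestFunction L ψ ∧ ∫ t in Ioo 0 L, |u t - ψ t| < ε ∧
      ∫ t in Ioo 0 L, |g t - deriv ψ t| < ε := by
  have hK : 0 < L ^ (1 - 1 / p) := by positivity
  obtain ⟨ψ, hψ, hlt⟩ := h.2 (ENNReal.ofReal (ε / L ^ (1 - 1 / p)))
    (ENNReal.ofReal_pos.2 (by positivity))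
  refine ⟨ψ, hψ, ?_⟩
  have key : ∀ {f : ℝ → ℝ}, AEStronglyMeasurable f (volume.restrict (Ioo 0 L)) →
      lpNormInterval p L f < ENNReal.ofReal (ε / L ^ (1 - 1 / p)) →
      ∫ t in Ioo 0 L, |f t| < ε := by
    intro f hf hlt
    rw [integral_abs_eq hf]
    refine (ENNReal.toReal_lt_of_lt_ofReal ((lpNormInterval_one_le hp hL hf).trans_lt ?_))
    calc lpNormInterval p L f * ENNReal.ofReal (L ^ (1 - 1 / p))
        < ENNReal.ofReal (ε / L ^ (1 - 1 / p)) * ENNReal.ofReal (L ^ (1 - 1 / p)) :=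
          ENNReal.mul_lt_mul_left (by simpa using hK) (by simp) hlt
      _ = ENNReal.ofReal ε := by
          rw [← ENNReal.ofReal_mul (by positivity), div_mul_cancel₀ _ hK.ne']
  exact ⟨key (h.1.1.1.sub hψ.1.continuous.aestronglyMeasurable) (lt_of_le_of_lt le_self_add hlt),
    key (h.1.2.1.1.sub hψ.derivative.1.continuous.aestronglyMeasurable)
      (lt_of_le_of_lt le_add_self hlt)⟩

/-- Integral identities extend from test functions to `W₀^{1,p}`. -/
theorem MemW01p.integral_mul_eq (hp : 1 < p) (hL : 0 < L) (h : MemW01p p L u g) {A B : ℝ → ℝ}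
    (hA : ContinuousOn A (Icc 0 L)) (hB : ContinuousOn B (Icc 0 L))
    (hAB : ∀ ψ, IsTestFunction L ψ →
      ∫ t in Ioo 0 L, A t * deriv ψ t = ∫ t in Ioo 0 L, B t * ψ t) :
    ∫ t in Ioo 0 L, A t * g t = ∫ t in Ioo 0 L, B t * u t := by
  obtain ⟨M, hM⟩ := isCompact_Icc.exists_bound_of_continuousOn hA
  obtain ⟨N, hN⟩ := isCompact_Icc.exists_bound_of_continuousOn hB
  have hM0 : 0 ≤ M := (norm_nonneg _).trans (hM 0 (left_mem_Icc.2 hL.le))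
  have hN0 : 0 ≤ N := (norm_nonneg _).trans (hN 0 (left_mem_Icc.2 hL.le))
  have hint : ∀ {A f : ℝ → ℝ} {M : ℝ}, ContinuousOn A (Icc 0 L) → (∀ x ∈ Icc 0 L, ‖A x‖ ≤ M) →
      IntegrableOn f (Ioo 0 L) → IntegrableOn (fun t => A t * f t) (Ioo 0 L) := by
    intro A f M hA hM hf
    refine hf.bdd_mul (c := M)
      ((hA.mono Ioo_subset_Icc_self).aestronglyMeasurable measurableSet_Ioo) ?_
    exact (ae_restrict_iff' measurableSet_Ioo).2
      (Eventually.of_forall fun x hx => hM x (Ioo_subset_Icc_self hx))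
  have hbound : ∀ {A f : ℝ → ℝ} {M : ℝ}, (∀ x ∈ Icc 0 L, ‖A x‖ ≤ M) →
      IntegrableOn f (Ioo 0 L) → |∫ t in Ioo 0 L, A t * f t| ≤ M * ∫ t in Ioo 0 L, |f t| := by
    intro A f M hM hf
    rw [← integral_const_mul, ← Real.norm_eq_abs]
    refine norm_integral_le_of_norm_le (hf.abs.const_mul M) ?_
    refine (ae_restrict_iff' measurableSet_Ioo).2 (Eventually.of_forall fun x hx => ?_)
    rw [norm_mul, Real.norm_eq_abs (f x)]
    exact mul_le_mul_of_nonneg_right (hM x (Ioo_subset_Icc_self hx)) (abs_nonneg _)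
  rw [← sub_eq_zero, ← abs_eq_zero]
  refine le_antisymm (le_of_forall_pos_le_add fun ε hε => ?_) (abs_nonneg _)
  -- The two errors contribute `M` and `N` shares; the extra `1` keeps the denominator positive.
  obtain ⟨ψ, hψ, h1, h2⟩ := h.exists_approx hp hL (ε := ε / (M + N + 1)) (by positivity)
  have hui := h.1.1.integrableOn hp
  have hgi := h.1.2.1.integrableOn hp
  have hψi : IntegrableOn ψ (Ioo 0 L) := hψ.memLpInterval.integrableOn hp
  have hψ'i : IntegrableOn (deriv ψ) (Ioo 0 L) := hψ.derivative.memLpInterval.integrableOn hp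
  have e1 : ∫ t in Ioo 0 L, A t * (g t - deriv ψ t)
      = (∫ t in Ioo 0 L, A t * g t) - ∫ t in Ioo 0 L, A t * deriv ψ t := by
    rw [← integral_sub (hint hA hM hgi) (hint hA hM hψ'i)]
    simp only [mul_sub]
  have e2 : ∫ t in Ioo 0 L, B t * (u t - ψ t)
      = (∫ t in Ioo 0 L, B t * u t) - ∫ t in Ioo 0 L, B t * ψ t := by
    rw [← integral_sub (hint hB hN hui) (hint hB hN hψi)]
    simp only [mul_sub]
  have e3 := hAB ψ hψ
  have b1 := hbound hM (hgi.sub hψ'i)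
  have b2 := hbound hN (hui.sub hψi)
  simp only [Pi.sub_apply] at b1 b2
  have : (∫ t in Ioo 0 L, A t * g t) - ∫ t in Ioo 0 L, B t * u t
      = (∫ t in Ioo 0 L, A t * (g t - deriv ψ t)) - ∫ t in Ioo 0 L, B t * (u t - ψ t) := by
    rw [e1, e2, e3]; ring
  rw [this]
  calc |(∫ t in Ioo 0 L, A t * (g t - deriv ψ t)) - ∫ t in Ioo 0 L, B t * (u t - ψ t)|
      ≤ M * (ε / (M + N + 1)) + N * (ε / (M + N + 1)) :=
        (abs_sub _ _).trans (add_le_add (b1.trans (by gcongr)) (b2.trans (by gcongr)))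
    _ ≤ 0 + ε := by
        rw [← add_mul, zero_add, ← mul_div_assoc, div_le_iff₀ (by positivity)]
        nlinarith

/-- This encodes the boundary condition at `L`, since `u` is the primitive of `g` starting from
zero. -/
theorem MemW01p.integral_eq_zero (hp : 1 < p) (hL : 0 < L) (h : MemW01p p L u g) :
    ∫ t in (0 : ℝ)..L, g t = 0 := by
  have := h.integral_mul_eq hp hL (A := fun _ => 1) (B := fun _ => 0) continuousOn_const
    continuousOn_const fun ψ hψ => by
      simp only [one_mul, zero_mul, integral_zero]
      rw [setIntegral_Ioo_eq hL, hψ.integral_deriv, hψ.eq_zero (by simp)]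
  simpa [setIntegral_Ioo_eq hL] using this

theorem abs_intervalIntegral_le {f : ℝ → ℝ} (hf : IntegrableOn f (Ioo 0 L)) {t : ℝ}
    (ht : t ∈ Icc 0 L) : |∫ s in (0 : ℝ)..t, f s| ≤ ∫ s in Ioo 0 L, |f s| := by
  rw [intervalIntegral.integral_of_le ht.1, integral_Ioc_eq_integral_Ioo]
  refine (abs_integral_le_integral_abs).trans (setIntegral_mono_set hf.abs
    (Eventually.of_forall fun x => abs_nonneg _)
    (Ioo_subset_Ioo_right ht.2).eventuallyLE)

theorem intervalIntegrable_of_Ioo {f : ℝ → ℝ} (hL : 0 ≤ L) (hf : IntegrableOn f (Ioo 0 L)) {t : ℝ}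
    (ht : t ∈ Icc 0 L) : IntervalIntegrable f volume 0 t := by
  have : IntervalIntegrable f volume 0 L :=
    (intervalIntegrable_iff_integrableOn_Ioo_of_le hL).2 hf
  exact this.mono_set (by rw [uIcc_of_le ht.1, uIcc_of_le hL]; exact Icc_subset_Icc_right ht.2)

theorem continuousOn_primitive_of_Ioo {f : ℝ → ℝ} (hL : 0 ≤ L) (hf : IntegrableOn f (Ioo 0 L)) :
    ContinuousOn (fun t => ∫ s in (0 : ℝ)..t, f s) (Icc 0 L) := by
  have := intervalIntegral.continuousOn_primitive_interval
    (f := f) (μ := volume) (a := 0) (b := L)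
    (by rwa [uIcc_of_le hL, integrableOn_Icc_iff_integrableOn_Ioo])
  rwa [uIcc_of_le hL] at this

/-- A test function equals the primitive of its derivative, and primitives differ uniformly by at
most the `L¹` distance of the derivatives. Hence `u - V` has arbitrarily small `L¹` norm. -/
theorem MemW01p.ae_eq_primitive (hp : 1 < p) (hL : 0 < L) (h : MemW01p p L u g) :
    ∀ᵐ t ∂(volume.restrict (Ioo 0 L)), u t = ∫ s in (0 : ℝ)..t, g s := by
  have hui := h.1.1.integrableOn hp
  have hgi := h.1.2.1.integrableOn hp
  set V : ℝ → ℝ := fun t => ∫ s in (0 : ℝ)..t, g s with hV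
  have hVi : IntegrableOn V (Ioo 0 L) :=
    ((continuousOn_primitive_of_Ioo hL.le hgi).integrableOn_Icc).mono_set Ioo_subset_Icc_self
  have hd : IntegrableOn (fun t => |u t - V t|) (Ioo 0 L) := (hui.sub hVi).abs
  have hz : ∫ t in Ioo 0 L, |u t - V t| = 0 := by
    refine le_antisymm (le_of_forall_pos_le_add fun ε hε => ?_)
      (integral_nonneg fun _ => abs_nonneg _)
    -- One share of `ε / (1 + L)` comes from `u - ψ`, and `L` shares from integrating the uniform
    -- bound on `ψ - V`.
    obtain ⟨ψ, hψ, h1, h2⟩ := h.exists_approx hp hL (ε := ε / (1 + L)) (by positivity)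
    have hψi : IntegrableOn ψ (Ioo 0 L) := hψ.memLpInterval.integrableOn hp
    have hψ'i : IntegrableOn (deriv ψ) (Ioo 0 L) := hψ.derivative.memLpInterval.integrableOn hp
    have hle : ∀ t ∈ Ioo 0 L, |u t - V t| ≤ |u t - ψ t| + ε / (1 + L) := by
      intro t ht
      have e : ψ t - V t = -∫ s in (0 : ℝ)..t, (g s - deriv ψ s) := by
        rw [intervalIntegral.integral_sub
          (intervalIntegrable_of_Ioo hL.le hgi (Ioo_subset_Icc_self ht))
          (intervalIntegrable_of_Ioo hL.le hψ'i (Ioo_subset_Icc_self ht)), hψ.integral_deriv]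
        ring
      have e2 := abs_intervalIntegral_le (hgi.sub hψ'i) (Ioo_subset_Icc_self ht)
      simp only [Pi.sub_apply] at e2
      calc |u t - V t| = |(u t - ψ t) + (ψ t - V t)| := by ring_nf
        _ ≤ |u t - ψ t| + |ψ t - V t| := abs_add_le _ _
        _ ≤ _ := by
          rw [e, abs_neg]
          exact add_le_add_right (e2.trans h2.le) _
    have hint : IntegrableOn (fun t => |u t - ψ t| + ε / (1 + L)) (Ioo 0 L) :=
      (hui.sub hψi).abs.add (integrableOn_const (by simp))
    refine (setIntegral_mono_on hd hint measurableSet_Ioo hle).trans ?_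
    rw [integral_add (f := fun t => |u t - ψ t|) (hui.sub hψi).abs (integrableOn_const (by simp)), setIntegral_const]
    simp only [Real.volume_real_Ioo_of_le hL.le, sub_zero, smul_eq_mul]
    calc _ ≤ ε / (1 + L) + L * (ε / (1 + L)) := by gcongr
      _ = 0 + ε := by field_simp; ring
  have := (integral_eq_zero_iff_of_nonneg_ae (Eventually.of_forall fun _ => abs_nonneg _) hd).1 hz
  filter_upwards [this] with t ht
  exact sub_eq_zero.1 (abs_eq_zero.1 ht)

end sobolev

/-! ### Primitives of continuous functions with zero mean belong to `W₀^{1,p}`. -/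

section density

variable {p L : ℝ} {u g : ℝ → ℝ}

theorem lpNormInterval_le_of_bound (hp : 1 < p) (hL : 0 < L) {f : ℝ → ℝ} {C : ℝ}
    (hf : ∀ᵐ t ∂(volume.restrict (Ioo 0 L)), |f t| ≤ C) :
    lpNormInterval p L f ≤ ENNReal.ofReal (L ^ p⁻¹ * C) := by
  refine (eLpNorm_le_of_ae_bound hf).trans (le_of_eq ?_)
  rw [ENNReal.toReal_ofReal (by linarith), ENNReal.ofReal_mul (by positivity)]
  simp only [MeasurableSet.univ, Measure.restrict_apply, univ_inter, Real.volume_Ioo, sub_zero]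
  rw [ENNReal.ofReal_rpow_of_pos hL]

/-- Continuous functions can be approximated in `L^p(0, L)` by test functions. -/
theorem exists_isTestFunction_lpNorm_sub_le (hp : 1 < p) (hL : 0 < L) (hg : Continuous g) {ε : ℝ}
    (hε : 0 < ε) : ∃ χ, IsTestFunction L χ ∧
      lpNormInterval p L (fun t => g t - χ t) ≤ ENNReal.ofReal ε := by
  obtain ⟨M, hM⟩ := isCompact_Icc.exists_bound_of_continuousOn (s := Icc 0 L) hg.continuousOn
  have hM0 : 0 ≤ M := (norm_nonneg _).trans (hM 0 (left_mem_Icc.2 hL.le))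
  -- The cutoff `c` below differs from `1` only on two end strips of total length at most `4 δ`. The
  -- resulting `L^p` error is at most `M * (4 δ) ^ (1 / p) = M * ε / (2 (M + 1)) ≤ ε / 2`.
  set δ : ℝ := (ε / (2 * (M + 1))) ^ p / 4 with hδ
  have hδ0 : 0 < δ := by positivity
  set c : ℝ → ℝ := fun t => min 1 (max 0 ((min t (L - t) - δ) / δ)) with hc
  have hcc : Continuous c := by
    refine continuous_const.min (continuous_const.max (Continuous.div_const ?_ δ))
    exact (continuous_id.min (continuous_const.sub continuous_id)).sub continuous_const
  have hc0 : ∀ t, 0 ≤ c t := fun t => le_min zero_le_one (le_max_left _ _)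
  have hc1 : ∀ t, c t ≤ 1 := fun t => min_le_left _ _
  have hcz : ∀ t, t ∉ Icc δ (L - δ) → c t = 0 := by
    intro t ht
    have : min t (L - t) ≤ δ := by
      by_contra! h
      have := lt_min_iff.1 h
      exact ht ⟨this.1.le, by linarith⟩
    have h2 : (min t (L - t) - δ) / δ ≤ 0 := div_nonpos_of_nonpos_of_nonneg (by linarith) hδ0.le
    simp only [hc, max_eq_left h2, min_eq_right zero_le_one]
  have hcone : ∀ t, 2 * δ ≤ t → t ≤ L - 2 * δ → c t = 1 := by
    intro t h1 h2
    have : 2 * δ ≤ min t (L - t) := le_min h1 (by linarith)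
    have h3 : 1 ≤ (min t (L - t) - δ) / δ := by rw [le_div_iff₀ hδ0]; linarith
    simp only [hc]
    exact min_eq_left (h3.trans (le_max_right _ _))
  have hL' : 0 < L ^ p⁻¹ := by positivity
  -- The smooth approximation is uniform and stays within the support of `g * c`, hence is compactly
  -- supported in the open interval.
  obtain ⟨χ, hχ1, hχ2, hχ3⟩ := (hg.mul hcc).exists_contDiff_approx ⊤
    (ε := fun _ => ε / (2 * L ^ p⁻¹)) continuous_const (fun _ => by positivity)
  have hsupp : Function.support χ ⊆ Icc δ (L - δ) := by
    intro t ht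
    by_contra hn
    exact hχ3 ht (by simp [hcz t hn])
  have hχ : IsTestFunction L χ := by
    refine ⟨hχ1, HasCompactSupport.of_support_subset_isCompact isCompact_Icc hsupp,
      (closure_minimal hsupp isClosed_Icc).trans fun x hx => ⟨hδ0.trans_le hx.1, ?_⟩⟩
    linarith [hx.2]
  refine ⟨χ, hχ, ?_⟩
  set S : Set ℝ := Icc 0 (2 * δ) ∪ Icc (L - 2 * δ) L with hS
  have hSm : MeasurableSet S := measurableSet_Icc.union measurableSet_Icc
  have e1 : lpNormInterval p L (fun t => g t * c t - χ t) ≤ ENNReal.ofReal (ε / 2) := by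
    refine (lpNormInterval_le_of_bound hp hL (C := ε / (2 * L ^ p⁻¹))
      (Eventually.of_forall fun t => ?_)).trans (le_of_eq ?_)
    · have := (hχ2 t).le
      rwa [dist_comm, Real.dist_eq] at this
    · congr 1
      field_simp
  have e2 : lpNormInterval p L (fun t => g t - g t * c t) ≤ ENNReal.ofReal (ε / 2) := by
    have h1 : lpNormInterval p L (fun t => g t - g t * c t)
        ≤ eLpNorm (S.indicator fun _ => M) (ENNReal.ofReal p) (volume.restrict (Ioo 0 L)) := by
      refine eLpNorm_mono_ae_real ((ae_restrict_iff' measurableSet_Ioo).2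
        (Eventually.of_forall fun t ht => ?_))
      by_cases htS : t ∈ S
      · rw [indicator_of_mem htS, show g t - g t * c t = g t * (1 - c t) by ring, norm_mul,
          Real.norm_eq_abs (1 - c t), abs_of_nonneg (by linarith [hc1 t])]
        exact (mul_le_of_le_one_right (norm_nonneg _) (by linarith [hc0 t])).trans
          (hM t (Ioo_subset_Icc_self ht))
      · rw [indicator_of_notMem htS]
        have h1 : 2 * δ ≤ t := by
          by_contra! h
          exact htS (Or.inl ⟨ht.1.le, h.le⟩)
        have h2 : t ≤ L - 2 * δ := by
          by_contra! h
          exact htS (Or.inr ⟨h.le, ht.2.le⟩)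
        simp [hcone t h1 h2]
    refine h1.trans ?_
    rw [eLpNorm_indicator_const hSm (by simpa using by linarith) (by simp),
      ENNReal.toReal_ofReal (by linarith)]
    have h3 : (volume.restrict (Ioo 0 L)) S ≤ ENNReal.ofReal (4 * δ) := by
      refine (Measure.restrict_apply_le _ _).trans ((measure_union_le _ _).trans ?_)
      rw [Real.volume_Icc, Real.volume_Icc, ← ENNReal.ofReal_add (by linarith) (by linarith)]
      exact ENNReal.ofReal_le_ofReal (by linarith)
    calc ‖M‖ₑ * (volume.restrict (Ioo 0 L)) S ^ (1 / p)
        ≤ ENNReal.ofReal M * ENNReal.ofReal (4 * δ) ^ (1 / p) := by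
          rw [Real.enorm_of_nonneg hM0]
          gcongr
      _ = ENNReal.ofReal (M * (ε / (2 * (M + 1)))) := by
          rw [ENNReal.ofReal_rpow_of_pos (by positivity), ← ENNReal.ofReal_mul hM0, hδ,
            mul_div_cancel₀ _ (by norm_num : (4 : ℝ) ≠ 0), one_div,
            Real.rpow_rpow_inv (by positivity) (by linarith)]
      _ ≤ ENNReal.ofReal (ε / 2) := by
          refine ENNReal.ofReal_le_ofReal ?_
          rw [← mul_div_assoc, div_le_div_iff₀ (by positivity) (by norm_num)]
          nlinarith
  have e3 : (fun t => g t - χ t) = (fun t => g t - g t * c t) + fun t => g t * c t - χ t := by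
    ext t; simp
  calc lpNormInterval p L (fun t => g t - χ t)
      ≤ lpNormInterval p L (fun t => g t - g t * c t) +
          lpNormInterval p L (fun t => g t * c t - χ t) := by
        rw [e3]
        exact eLpNorm_add_le (hg.sub (hg.mul hcc)).aestronglyMeasurable
          ((hg.mul hcc).sub hχ1.continuous).aestronglyMeasurable (one_le_ofReal hp)
    _ ≤ ENNReal.ofReal (ε / 2) + ENNReal.ofReal (ε / 2) := add_le_add e2 e1
    _ = ENNReal.ofReal ε := by
        rw [← ENNReal.ofReal_add (by positivity) (by positivity), add_halves]

theorem memLpInterval_of_continuous (hg : Continuous g) :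
    MemLpInterval p L g := by
  obtain ⟨M, hM⟩ := isCompact_Icc.exists_bound_of_continuousOn (s := Icc 0 L) hg.continuousOn
  refine MemLp.of_bound hg.aestronglyMeasurable M ?_
  exact (ae_restrict_iff' measurableSet_Ioo).2
    (Eventually.of_forall fun x hx => hM x (Ioo_subset_Icc_self hx))

/-- The approximant is the primitive of `χ - m η`, where `χ` is a test function close to `g` and `m`
its mean. Because `g` has zero mean, `m` is small, and the correction makes the primitive a test
function. -/
theorem memW01p_primitive (hp : 1 < p) (hL : 0 < L) (hg : Continuous g)
    (h0 : ∫ t in (0 : ℝ)..L, g t = 0)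
    (hu : ∀ᵐ t ∂(volume.restrict (Ioo 0 L)), u t = ∫ s in (0 : ℝ)..t, g s) :
    MemW01p p L u g := by
  set V : ℝ → ℝ := fun t => ∫ s in (0 : ℝ)..t, g s with hV
  have hVd : ∀ t, HasDerivAt V (g t) t := fun t => (hg.integral_hasStrictDerivAt 0 t).hasDerivAt
  have hVc : Continuous V := continuous_iff_continuousAt.2 fun t => (hVd t).continuousAt
  have huV : u =ᵐ[volume.restrict (Ioo 0 L)] V := hu
  have hLint : LocallyIntegrableOn u (Ioo 0 L) := by
    have : IntegrableOn V (Ioo 0 L) := (hVc.integrableOn_Icc).mono_set Ioo_subset_Icc_self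
    exact IntegrableOn.locallyIntegrableOn (this.congr huV.symm)
  have hgi : IntegrableOn g (Ioo 0 L) := (hg.integrableOn_Icc).mono_set Ioo_subset_Icc_self
  refine ⟨⟨(memLp_congr_ae huV).2 (memLpInterval_of_continuous hVc),
    memLpInterval_of_continuous hg, hLint, hg.locallyIntegrable.locallyIntegrableOn _,
    fun ψ hψ => ?_⟩, fun ε hε => ?_⟩
  · rw [← hψ.integral_mul_deriv hL (fun t _ => hVd t) hg.continuousOn]
    refine integral_congr_ae (huV.mono fun t ht => ?_)
    simp only [ht]
  obtain ⟨η, hη, hη1⟩ := exists_isTestFunction_integral_eq_one hL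
  set N : ℝ := (lpNormInterval p L η).toReal with hN
  have hNη : lpNormInterval p L η = ENNReal.ofReal N :=
    (ENNReal.ofReal_toReal hη.memLpInterval.eLpNorm_ne_top).symm
  have hN0 : 0 ≤ N := ENNReal.toReal_nonneg
  set K : ℝ := L ^ (1 - 1 / p) with hK
  have hK0 : 0 < K := by positivity
  have hL1 : ∀ {f : ℝ → ℝ} {d : ℝ}, Continuous f → 0 ≤ d →
      lpNormInterval p L f ≤ ENNReal.ofReal d → ∫ t in Ioo 0 L, |f t| ≤ d * K := by
    intro f d hf hd hfd
    rw [integral_abs_eq hf.aestronglyMeasurable]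
    refine ENNReal.toReal_le_of_le_ofReal (by positivity) ?_
    refine (lpNormInterval_one_le hp hL hf.aestronglyMeasurable).trans ?_
    rw [ENNReal.ofReal_mul hd]
    gcongr
  -- The tolerance `ε` may be infinite, so a finite one is inserted below it.
  obtain ⟨e, he0, heε⟩ := ENNReal.lt_iff_exists_real_btwn.1 hε
  have he : 0 < e := by simpa using heε.1
  -- The factor `1 + K * N` is the cost of correcting the mean. The factor `1 + L ^ p⁻¹ * K` adds to
  -- the error of the derivatives that of the functions, bounded through `L¹` and the supremum.
  set D : ℝ := (1 + K * N) * (1 + L ^ p⁻¹ * K) with hD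
  have hD0 : 0 < D := by positivity
  obtain ⟨χ, hχ, hχg⟩ := exists_isTestFunction_lpNorm_sub_le hp hL hg (ε := e / D) (by positivity)
  have hχi : IntegrableOn χ (Ioo 0 L) := hχ.memLpInterval.integrableOn hp
  have hηi : IntegrableOn η (Ioo 0 L) := hη.memLpInterval.integrableOn hp
  set m := ∫ t in Ioo 0 L, χ t with hm
  have hmle : |m| ≤ e / D * K := by
    have h1 : ∫ t in Ioo 0 L, (g t - χ t) = -m := by
      rw [integral_sub hgi hχi, setIntegral_Ioo_eq hL, h0, zero_sub]
    rw [← abs_neg, ← h1]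
    exact abs_integral_le_integral_abs.trans
      (hL1 (hg.sub hχ.1.continuous) (by positivity) hχg)
  have hT := hχ.sub_const_mul hη m
  have hT0 : ∫ t in Ioo 0 L, (χ t - m * η t) = 0 := by
    rw [integral_sub hχi (hηi.const_mul m), integral_const_mul, hη1]
    simp [hm]
  obtain ⟨hψ, hψ'⟩ := hT.exists_primitive hL hT0
  have hgT : lpNormInterval p L (fun t => g t - (χ t - m * η t))
      ≤ ENNReal.ofReal (e / D * (1 + K * N)) := by
    have e1 : (fun t => g t - (χ t - m * η t)) = (fun t => g t - χ t) + m • η := by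
      ext t; simp; ring
    rw [e1]
    refine (eLpNorm_add_le (hg.sub hχ.1.continuous).aestronglyMeasurable
      (hη.1.continuous.const_smul m).aestronglyMeasurable (one_le_ofReal hp)).trans ?_
    rw [eLpNorm_const_smul]
    change lpNormInterval p L _ + ‖m‖ₑ * lpNormInterval p L η ≤ _
    calc _ ≤ ENNReal.ofReal (e / D) + ENNReal.ofReal (e / D * K) * ENNReal.ofReal N := by
          rw [hNη, Real.enorm_eq_ofReal_abs]
          gcongr
          exact hχg
      _ = _ := by
          rw [← ENNReal.ofReal_mul (by positivity),
            ← ENNReal.ofReal_add (by positivity) (by positivity)]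
          congr 1
          ring
  refine ⟨_, hψ, lt_of_le_of_lt ?_ heε.2⟩
  rw [hψ']
  have hint := hL1 (hg.sub hT.1.continuous) (by positivity) hgT
  have huψ : lpNormInterval p L (fun t => u t - ∫ s in (0 : ℝ)..t, (χ s - m * η s))
      ≤ ENNReal.ofReal (L ^ p⁻¹ * (e / D * (1 + K * N) * K)) := by
    refine lpNormInterval_le_of_bound hp hL ?_
    filter_upwards [huV, ae_restrict_mem measurableSet_Ioo] with t ht htI
    rw [ht, hV, ← intervalIntegral.integral_sub (hg.intervalIntegrable _ _)
      (hT.1.continuous.intervalIntegrable _ _)]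
    exact (abs_intervalIntegral_le (hgi.sub (hT.memLpInterval.integrableOn hp))
      (Ioo_subset_Icc_self htI)).trans hint
  calc _ ≤ ENNReal.ofReal (L ^ p⁻¹ * (e / D * (1 + K * N) * K)) +
        ENNReal.ofReal (e / D * (1 + K * N)) := add_le_add huψ hgT
    _ = ENNReal.ofReal e := by
        rw [← ENNReal.ofReal_add (by positivity) (by positivity)]
        congr 1
        rw [hD]
        field_simp
        ring

end density

/-! ### Weak solutions are solutions of the first-order system -/

section weak

variable {p a b lam L : ℝ} {u g : ℝ → ℝ}

theorem integrableOn_flux (hp : 1 < p) (ha : 0 < a) (hb : 0 < b) (hg : MemLpInterval p L g) :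
    IntegrableOn (fun t => flux p a b (g t)) (Ioo 0 L) := by
  have h1 : Integrable (fun t => ‖g t‖ ^ p) (volume.restrict (Ioo 0 L)) := by
    have := MemLp.integrable_norm_rpow hg (by simpa using by linarith) (by simp)
    rwa [ENNReal.toReal_ofReal (by linarith)] at this
  have h2 : Integrable (fun t => (a ^ p + b ^ p) * (1 + ‖g t‖ ^ p)) (volume.restrict (Ioo 0 L)) :=
    ((integrable_const 1).add h1).const_mul _
  refine Integrable.mono' h2 ((continuous_flux hp).comp_aestronglyMeasurable hg.1)
    (Eventually.of_forall fun t => ?_)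
  have key : ∀ x : ℝ, 0 ≤ x → x ≤ ‖g t‖ → x ^ (p - 1) ≤ 1 + ‖g t‖ ^ p := by
    intro x hx hxg
    have hg0 : 0 ≤ ‖g t‖ ^ p := by positivity
    rcases le_total x 1 with h | h
    · linarith [Real.rpow_le_one hx h (by linarith : 0 ≤ p - 1)]
    · have h3 : x ^ (p - 1) ≤ x ^ p := Real.rpow_le_rpow_of_exponent_le h (by linarith)
      have h4 : x ^ p ≤ ‖g t‖ ^ p := Real.rpow_le_rpow hx hxg (by linarith)
      linarith
  have k1 := key (max (g t) 0) (le_max_right _ _) (max_le (le_abs_self _) (norm_nonneg _))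
  have k2 := key (max (-g t) 0) (le_max_right _ _) (max_le (neg_le_abs _) (norm_nonneg _))
  have p1 : 0 ≤ max (g t) 0 ^ (p - 1) := by positivity
  have p2 : 0 ≤ max (-g t) 0 ^ (p - 1) := by positivity
  have ha' : 0 < a ^ p := by positivity
  have hb' : 0 < b ^ p := by positivity
  rw [flux, Real.norm_eq_abs]
  refine (abs_sub _ _).trans ?_
  rw [abs_of_nonneg (by positivity), abs_of_nonneg (by positivity), add_mul]
  gcongr

/-- With `F' = |u|^(p-2) u`, the weak equation says that `flux (u') + lam F` is annihilated by
derivatives of test functions, hence constant. So `W = w - lam F` is a continuously differentiable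
version of the flux, and inverting the flux makes `u'` continuous. Conversely, the second equation
integrated by parts against test functions extends to `W₀^{1,p}`. -/
theorem isWeakSolution_iff (hp : 1 < p) (ha : 0 < a) (hb : 0 < b) (hL : 0 < L) :
    IsWeakSolution p a b L lam u ↔ ∃ U W, IsSystemSol p a b lam U W (Icc 0 L) ∧ U 0 = 0 ∧ U L = 0 ∧
      ∀ᵐ t ∂(volume.restrict (Ioo 0 L)), u t = U t := by
  have hfc : Continuous (apow (p - 1) 1 1) := continuous_apow (by linarith)
  constructor
  · rintro ⟨g, hW, hweak⟩
    have hgi := hW.1.2.1.integrableOn hp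
    set V : ℝ → ℝ := fun t => ∫ s in (0 : ℝ)..t, g s with hV
    have hVc : ContinuousOn V (Icc 0 L) := continuousOn_primitive_of_Ioo hL.le hgi
    have huV := hW.ae_eq_primitive hp hL
    -- Constant extension beyond `[0, L]` makes the primitives differentiable from both sides at the
    -- endpoints, as `IsSystemSol` requires.
    set Vt : ℝ → ℝ := IccExtend hL.le ((Icc 0 L).domRestrict V) with hVt
    have hVtc : Continuous Vt := (continuousOn_iff_continuous_domRestrict.1 hVc).Icc_extend'
    have hVtV : ∀ t ∈ Icc 0 L, Vt t = V t := fun t ht => by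
      rw [hVt, IccExtend_of_mem _ _ ht, domRestrict_apply]
    set F : ℝ → ℝ := fun t => ∫ s in (0 : ℝ)..t, apow (p - 1) 1 1 (Vt s) with hF
    have hFd : ∀ t, HasDerivAt F (apow (p - 1) 1 1 (Vt t)) t := fun t =>
      ((hfc.comp hVtc).integral_hasStrictDerivAt 0 t).hasDerivAt
    have hFc : Continuous F := continuous_iff_continuousAt.2 fun t => (hFd t).continuousAt
    have hfl := integrableOn_flux hp ha hb hW.1.2.1
    have hFi : IntegrableOn (fun t => lam * F t) (Ioo 0 L) :=
      ((continuous_const.mul hFc).integrableOn_Icc).mono_set Ioo_subset_Icc_self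
    obtain ⟨w, hw⟩ := exists_ae_eq_const hL (hfl.add hFi) fun ψ hψ => by
      have e1 := hweak ψ (deriv ψ) (hψ.memW01p hL)
      have e2 := hψ.integral_mul_deriv hL (fun t _ => (hFd t).const_mul lam)
        (continuous_const.mul (hfc.comp hVtc)).continuousOn
      have e3 : ∫ t in Ioo 0 L, |u t| ^ (p - 2) * u t * ψ t
          = ∫ t in Ioo 0 L, apow (p - 1) 1 1 (Vt t) * ψ t := by
        refine integral_congr_ae ?_
        filter_upwards [huV, ae_restrict_mem measurableSet_Ioo] with t ht htI
        rw [abs_rpow_mul_self p _ hp, ht, hVtV t (Ioo_subset_Icc_self htI)]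
      rw [e3, ← integral_const_mul] at e1
      simp only [Pi.add_apply, add_mul]
      rw [integral_add (hψ.derivative.integrable_mul hfl) (hψ.derivative.integrable_mul hFi), e1,
        e2, ← sub_eq_add_neg, sub_eq_zero]
      congr 1 with t
      ring
    set W : ℝ → ℝ := fun t => w - lam * F t with hWdef
    have hWc : Continuous W := continuous_const.sub (continuous_const.mul hFc)
    have hgW : ∀ᵐ t ∂(volume.restrict (Ioo 0 L)), g t = fluxInv p a b (W t) := by
      filter_upwards [hw] with t ht
      simp only [Pi.add_apply] at ht
      rw [← fluxInv_flux hp ha hb (g t)]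
      congr 1
      simp only [hWdef]
      linarith
    have hUV : ∀ t ∈ Icc 0 L, ∫ s in (0 : ℝ)..t, fluxInv p a b (W s) = V t := by
      intro t ht
      simp only [hV]
      rw [intervalIntegral.integral_of_le ht.1, intervalIntegral.integral_of_le ht.1,
        integral_Ioc_eq_integral_Ioo, integral_Ioc_eq_integral_Ioo]
      refine integral_congr_ae ?_
      filter_upwards [ae_restrict_of_ae_restrict_of_subset (Ioo_subset_Ioo_right ht.2) hgW]
        with s hs
      exact hs.symm
    refine ⟨fun t => ∫ s in (0 : ℝ)..t, fluxInv p a b (W s), W, fun t ht => ⟨?_, ?_⟩, by simp, ?_,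
      ?_⟩
    · exact (((continuous_fluxInv hp).comp hWc).integral_hasStrictDerivAt 0 t).hasDerivAt
    · simp only [hUV t ht, ← hVtV t ht]
      exact ((hFd t).const_mul lam).const_sub w
    · simp only [hUV L (right_mem_Icc.2 hL.le)]
      exact hW.integral_eq_zero hp hL
    · filter_upwards [huV, ae_restrict_mem measurableSet_Ioo] with t ht htI
      rw [hUV t (Ioo_subset_Icc_self htI), ht]
  · rintro ⟨U, W, hsol, hU0, hUL, huU⟩
    have hUc : ContinuousOn U (Icc 0 L) := fun t ht =>
      (hsol t ht).1.continuousAt.continuousWithinAt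
    have hWc : ContinuousOn W (Icc 0 L) := fun t ht =>
      (hsol t ht).2.continuousAt.continuousWithinAt
    set Wt : ℝ → ℝ := IccExtend hL.le ((Icc 0 L).domRestrict W) with hWt
    have hWtc : Continuous Wt := (continuousOn_iff_continuous_domRestrict.1 hWc).Icc_extend'
    have hWtW : ∀ t ∈ Icc 0 L, Wt t = W t := fun t ht => by
      rw [hWt, IccExtend_of_mem _ _ ht, domRestrict_apply]
    have hgc : Continuous fun t => fluxInv p a b (Wt t) := (continuous_fluxInv hp).comp hWtc
    have hUint : ∀ t ∈ Icc 0 L, ∫ s in (0 : ℝ)..t, fluxInv p a b (Wt s) = U t := by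
      intro t ht
      rw [intervalIntegral.integral_eq_sub_of_hasDerivAt (f := U) (fun s hs => ?_)
        (hgc.intervalIntegrable _ _), hU0, sub_zero]
      rw [uIcc_of_le ht.1] at hs
      have hs' : s ∈ Icc 0 L := ⟨hs.1, hs.2.trans ht.2⟩
      rw [hWtW s hs']
      exact (hsol s hs').1
    refine ⟨fun t => fluxInv p a b (Wt t), memW01p_primitive hp hL hgc ?_ ?_, fun v h hv => ?_⟩
    · rw [hUint L (right_mem_Icc.2 hL.le), hUL]
    · filter_upwards [huU, ae_restrict_mem measurableSet_Ioo] with t ht htI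
      rw [hUint t (Ioo_subset_Icc_self htI), ht]
    · have key := hv.integral_mul_eq hp hL (A := W) (B := fun t => lam * apow (p - 1) 1 1 (U t))
        hWc (continuousOn_const.mul (hfc.comp_continuousOn hUc)) fun ψ hψ => by
          rw [hψ.integral_mul_deriv hL (fun t ht => (hsol t ht).2)
            (continuousOn_const.mul (hfc.comp_continuousOn hUc)).neg, ← integral_neg]
          simp only [neg_mul, neg_neg]
      rw [← integral_const_mul]
      refine Eq.trans (setIntegral_congr_fun measurableSet_Ioo fun t ht => ?_)
        (key.trans (integral_congr_ae ?_))
      · simp only [flux_fluxInv hp ha hb, hWtW t (Ioo_subset_Icc_self ht)]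
      · filter_upwards [huU] with t ht
        rw [abs_rpow_mul_self p _ hp, ht]
        ring

end weak

/-! ### The generalized sine -/

section sine

variable {p : ℝ}

/-- The derivative of the generalized arcsine on `(0, 1)`, extended by `1`. -/
noncomputable def arcsinDensity (p t : ℝ) : ℝ :=
  1 + (Ico (0 : ℝ) 1).indicator (fun t => (1 - t ^ p) ^ (-(1 / p)) - 1) t

theorem one_sub_rpow_mem (hp : 1 < p) {t : ℝ} (ht : t ∈ Ico (0 : ℝ) 1) :
    1 - t ≤ 1 - t ^ p ∧ 0 < 1 - t ^ p ∧ 1 - t ^ p ≤ 1 := by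
  have h1 : t ^ p ≤ t := by
    simpa using Real.rpow_le_rpow_of_exponent_ge' ht.1 ht.2.le zero_le_one hp.le
  have h2 : 0 ≤ t ^ p := Real.rpow_nonneg ht.1 _
  exact ⟨by linarith, by linarith [ht.2], by linarith⟩

/-- Since `t ^ p ≤ t` on `[0, 1)`, the integrand is at most `(1 - t) ^ (-(1 / p))`, which is
integrable because `1 / p < 1`. -/
theorem integrableOn_arcsin (hp : 1 < p) :
    IntegrableOn (fun t : ℝ => (1 - t ^ p) ^ (-(1 / p))) (Ico 0 1) := by
  have hr : -1 < -(1 / p) := by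
    have : 1 / p < 1 := by rw [div_lt_one (by linarith)]; exact hp
    linarith
  have h1 : IntegrableOn (fun t : ℝ => (1 - t) ^ (-(1 / p))) (Ico 0 1) := by
    have h : IntervalIntegrable (fun t : ℝ => t ^ (-(1 / p))) volume 0 1 :=
      intervalIntegral.intervalIntegrable_rpow' hr
    have h2 := (h.comp_sub_left 1).symm
    simp only [sub_self, sub_zero] at h2
    rw [intervalIntegrable_iff_integrableOn_Ioc_of_le zero_le_one] at h2
    exact h2.congr_set_ae Ico_ae_eq_Ioc
  refine Integrable.mono' h1 ?_ ((ae_restrict_iff' measurableSet_Ico).2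
    (Eventually.of_forall fun t ht => ?_))
  · have : Measurable fun t : ℝ => (1 - t ^ p) ^ (-(1 / p)) := by fun_prop
    exact this.aestronglyMeasurable
  · obtain ⟨e1, e2, e3⟩ := one_sub_rpow_mem hp ht
    rw [Real.norm_eq_abs, abs_of_pos (by positivity)]
    refine Real.rpow_le_rpow_of_nonpos (by linarith [ht.2]) e1 ?_
    rw [neg_nonpos]
    positivity

theorem intervalIntegrable_arcsinDensity (hp : 1 < p) (x y : ℝ) :
    IntervalIntegrable (arcsinDensity p) volume x y := by
  have h1 : Integrable ((Ico (0 : ℝ) 1).indicator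
      (fun t : ℝ => (1 - t ^ p) ^ (-(1 / p)) - 1)) :=
    ((integrableOn_arcsin hp).sub (integrableOn_const (by simp))).integrable_indicator
      measurableSet_Ico
  exact (intervalIntegrable_const).add h1.intervalIntegrable

theorem one_le_arcsinDensity (hp : 1 < p) (t : ℝ) : 1 ≤ arcsinDensity p t := by
  refine le_add_of_nonneg_right (indicator_nonneg (fun t ht => ?_) t)
  obtain ⟨_, e2, e3⟩ := one_sub_rpow_mem hp ht
  rw [sub_nonneg]
  refine Real.one_le_rpow_of_pos_of_le_one_of_nonpos e2 e3 ?_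
  rw [neg_nonpos]
  positivity

theorem arcsinDensity_of_mem {t : ℝ} (ht : t ∈ Ico (0 : ℝ) 1) :
    arcsinDensity p t = (1 - t ^ p) ^ (-(1 / p)) := by
  rw [arcsinDensity, indicator_of_mem ht]
  ring

/-- The generalized arcsine. -/
noncomputable def arcsinP (p x : ℝ) : ℝ := ∫ t in (0 : ℝ)..x, arcsinDensity p t

/-- The density is at least `1` on the whole line thanks to its extension, so `arcsinP` does not
contract distances. It is therefore a strictly increasing bijection of `ℝ` with a globally defined
inverse. -/
theorem sub_le_arcsinP_sub (hp : 1 < p) {x y : ℝ} (hxy : x ≤ y) :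
    y - x ≤ arcsinP p y - arcsinP p x := by
  have hi := intervalIntegrable_arcsinDensity hp
  rw [arcsinP, arcsinP, intervalIntegral.integral_interval_sub_left (hi _ _) (hi _ _)]
  have := intervalIntegral.integral_mono_on hxy (intervalIntegrable_const (c := (1 : ℝ))
    (μ := volume)) (hi x y) fun t _ => one_le_arcsinDensity hp t
  simpa using this

theorem arcsinP_zero : arcsinP p 0 = 0 := by simp [arcsinP]

theorem strictMono_arcsinP (hp : 1 < p) : StrictMono (arcsinP p) := fun x y hxy => by
  linarith [sub_le_arcsinP_sub hp hxy.le]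

theorem continuous_arcsinP (hp : 1 < p) : Continuous (arcsinP p) :=
  intervalIntegral.continuous_primitive (intervalIntegrable_arcsinDensity hp) 0

theorem surjective_arcsinP (hp : 1 < p) : Function.Surjective (arcsinP p) := by
  refine (continuous_arcsinP hp).surjective ?_ ?_
  · refine tendsto_atTop_mono' _ ?_ tendsto_id
    filter_upwards [eventually_ge_atTop 0] with x hx
    have := sub_le_arcsinP_sub hp hx
    rw [arcsinP_zero] at this
    simpa using this
  · refine tendsto_atBot_mono' _ ?_ tendsto_id
    filter_upwards [eventually_le_atBot 0] with x hx
    have := sub_le_arcsinP_sub hp hx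
    rw [arcsinP_zero] at this
    simp only [id]
    linarith

theorem arcsinP_one : arcsinP p 1 = piP p / 2 := by
  rw [piP, mul_div_cancel_left₀ _ (two_ne_zero), arcsinP, intervalIntegral.integral_of_le
    zero_le_one, intervalIntegral.integral_of_le zero_le_one, integral_Ioc_eq_integral_Ioo,
    integral_Ioc_eq_integral_Ioo]
  exact setIntegral_congr_fun measurableSet_Ioo fun t ht =>
    arcsinDensity_of_mem (Ioo_subset_Ico_self ht)

theorem piP_pos (hp : 1 < p) : 0 < piP p := by
  have := sub_le_arcsinP_sub hp zero_le_one
  rw [arcsinP_one, arcsinP_zero] at this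
  linarith

theorem hasDerivAt_arcsinP (hp : 1 < p) {x : ℝ} (hx : x ∈ Ioo (0 : ℝ) 1) :
    HasDerivAt (arcsinP p) ((1 - x ^ p) ^ (-(1 / p))) x := by
  rw [← arcsinDensity_of_mem (Ioo_subset_Ico_self hx)]
  have hm : Measurable (arcsinDensity p) := by
    refine measurable_const.add (Measurable.indicator ?_ measurableSet_Ico)
    fun_prop
  refine intervalIntegral.integral_hasDerivAt_right (intervalIntegrable_arcsinDensity hp _ _)
    hm.stronglyMeasurable.stronglyMeasurableAtFilter ?_
  have hev : arcsinDensity p =ᶠ[𝓝 x] fun t => (1 - t ^ p) ^ (-(1 / p)) := by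
    filter_upwards [Ioo_mem_nhds hx.1 hx.2] with t ht
    exact arcsinDensity_of_mem (Ioo_subset_Ico_self ht)
  refine ContinuousAt.congr ?_ hev.symm
  have h0 := (one_sub_rpow_mem hp (Ioo_subset_Ico_self hx)).2.1
  exact ((continuousAt_const.sub (continuousAt_id.rpow_const (Or.inl hx.1.ne'))).rpow_const
    (Or.inl h0.ne'))

/-- `σ` is a generalized sine with quarter period `1`. -/
structure IsQuarterSine (p : ℝ) (σ : ℝ → ℝ) : Prop where
  continuous : Continuous σ
  strictMono : StrictMono σ
  map_zero : σ 0 = 0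
  map_one : σ 1 = 1
  hasDerivAt : ∀ x ∈ Ioo (0 : ℝ) 1,
    HasDerivAt σ (piP p / 2 * (1 - σ x ^ p) ^ (1 / p)) x

/-- The witness is the inverse of `arcsinP` with its argument rescaled by `piP p / 2 = arcsinP p 1`,
so that the quarter period becomes `1`. -/
theorem exists_isQuarterSine (hp : 1 < p) : ∃ σ, IsQuarterSine p σ := by
  set e := (strictMono_arcsinP hp).orderIsoOfSurjective _ (surjective_arcsinP hp) with he
  have hea : ∀ x, e x = arcsinP p x := fun x => rfl
  have hh := piP_pos hp
  have h0 : e.symm 0 = 0 := by rw [e.symm_apply_eq, hea, arcsinP_zero]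
  have h1 : e.symm (piP p / 2) = 1 := by rw [e.symm_apply_eq, hea, arcsinP_one]
  refine ⟨fun x => e.symm (piP p / 2 * x), ⟨e.symm.continuous.comp (continuous_const.mul
    continuous_id), fun x y hxy => e.symm.strictMono (by gcongr), by simp [h0], by simp [h1],
    fun x hx => ?_⟩⟩
  have hy : e.symm (piP p / 2 * x) ∈ Ioo (0 : ℝ) 1 := by
    constructor
    · rw [← h0]
      exact e.symm.strictMono (mul_pos (by linarith) hx.1)
    · rw [← h1]
      exact e.symm.strictMono (mul_lt_of_lt_one_right (by linarith) hx.2)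
  have hpos := (one_sub_rpow_mem hp (Ioo_subset_Ico_self hy)).2.1
  have hd : HasDerivAt (fun y => e.symm y) ((1 - e.symm (piP p / 2 * x) ^ p) ^ (-(1 / p)))⁻¹
      (piP p / 2 * x) :=
    HasDerivAt.of_local_left_inverse e.symm.continuous.continuousAt (hasDerivAt_arcsinP hp hy)
      (by positivity) (Eventually.of_forall fun y => e.apply_symm_apply y)
  rw [Real.rpow_neg hpos.le, inv_inv] at hd
  have := hd.comp x ((hasDerivAt_id x).const_mul (piP p / 2))
  refine this.congr_deriv ?_
  ring

/-- The companion cosine of a generalized sine. -/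
noncomputable def quarterCos (p : ℝ) (σ : ℝ → ℝ) (x : ℝ) : ℝ := (1 - σ x ^ p) ^ ((p - 1) / p)

variable {σ : ℝ → ℝ}

theorem IsQuarterSine.mem_Ioo (hσ : IsQuarterSine p σ) {x : ℝ} (hx : x ∈ Ioo (0 : ℝ) 1) :
    σ x ∈ Ioo (0 : ℝ) 1 :=
  ⟨hσ.map_zero ▸ hσ.strictMono hx.1, hσ.map_one ▸ hσ.strictMono hx.2⟩

theorem IsQuarterSine.continuous_cos (hσ : IsQuarterSine p σ) (hp : 1 < p) :
    Continuous (quarterCos p σ) :=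
  (continuous_const.sub (hσ.continuous.rpow_const fun _ => Or.inr (by linarith))).rpow_const
    fun _ => Or.inr (div_nonneg (by linarith) (by linarith))

theorem IsQuarterSine.cos_zero (hσ : IsQuarterSine p σ) (hp : 1 < p) : quarterCos p σ 0 = 1 := by
  rw [quarterCos, hσ.map_zero, Real.zero_rpow (by linarith), sub_zero, Real.one_rpow]

theorem IsQuarterSine.cos_one (hσ : IsQuarterSine p σ) (hp : 1 < p) : quarterCos p σ 1 = 0 := by
  rw [quarterCos, hσ.map_one, Real.one_rpow, sub_self, Real.zero_rpow]
  exact (div_pos (by linarith) (by linarith)).ne'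

theorem IsQuarterSine.cos_pos (hσ : IsQuarterSine p σ) (hp : 1 < p) {x : ℝ}
    (hx : x ∈ Ioo (0 : ℝ) 1) : 0 < quarterCos p σ x :=
  Real.rpow_pos_of_pos (one_sub_rpow_mem hp (Ioo_subset_Ico_self (hσ.mem_Ioo hx))).2.1 _

/-- The exponent in `quarterCos` makes it proportional to `(σ') ^ (p - 1)`: it plays the role of the
flux of `σ`, not of its derivative. -/
theorem IsQuarterSine.cos_rpow_inv (hσ : IsQuarterSine p σ) (hp : 1 < p) {x : ℝ}
    (hx : x ∈ Ioo (0 : ℝ) 1) :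
    (1 - σ x ^ p) ^ (1 / p) = quarterCos p σ x ^ (p - 1)⁻¹ := by
  have h := (one_sub_rpow_mem hp (Ioo_subset_Ico_self (hσ.mem_Ioo hx))).2.1
  rw [quarterCos, ← Real.rpow_mul h.le]
  congr 1
  have : p - 1 ≠ 0 := by linarith
  field_simp

theorem IsQuarterSine.hasDerivAt_cos (hσ : IsQuarterSine p σ) (hp : 1 < p) {x : ℝ}
    (hx : x ∈ Ioo (0 : ℝ) 1) :
    HasDerivAt (quarterCos p σ) (-((p - 1) * (piP p / 2) * σ x ^ (p - 1))) x := by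
  have hs := hσ.mem_Ioo hx
  have h := (one_sub_rpow_mem hp (Ioo_subset_Ico_self hs)).2.1
  have h1 := (((hσ.hasDerivAt x hx).rpow_const (p := p) (Or.inl hs.1.ne')).const_sub
    1).rpow_const (p := (p - 1) / p) (Or.inl h.ne')
  refine h1.congr_deriv ?_
  -- The root coming from `σ'` cancels the singular power coming from the outer derivative.
  have e : (1 - σ x ^ p) ^ (1 / p) * (1 - σ x ^ p) ^ ((p - 1) / p - 1) = 1 := by
    rw [← Real.rpow_add h]
    have : 1 / p + ((p - 1) / p - 1) = 0 := by field_simp; ring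
    rw [this, Real.rpow_zero]
  have hp0 : p ≠ 0 := by linarith
  have hp1 : p * ((p - 1) / p) = p - 1 := by field_simp
  linear_combination (-(piP p / 2 * σ x ^ (p - 1) * (p * ((p - 1) / p)))) * e -
    (piP p / 2 * σ x ^ (p - 1)) * hp1

end sine

/-! ### The reference solution -/

section reference

variable {p a b : ℝ} {σ : ℝ → ℝ}

/-- The positive bump `x ↦ σ (2 x)` on `[0, 1/2]`, reflected about `1/2`. -/
noncomputable def bump (σ : ℝ → ℝ) (x : ℝ) : ℝ := σ (min (2 * x) (2 - 2 * x))

/-- The asymmetric positive bump on `[0, 1]`. -/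
noncomputable def arch (a b : ℝ) (σ : ℝ → ℝ) (t : ℝ) : ℝ :=
  σ (min (t / (a / (a + b))) ((1 - t) / (b / (a + b))))

/-- The flux of `arch`. -/
noncomputable def archFlux (p a b : ℝ) (σ : ℝ → ℝ) (t : ℝ) : ℝ :=
  ((a + b) * (piP p / 2)) ^ (p - 1) *
    (a * quarterCos p σ (min 1 (t / (a / (a + b)))) -
      b * quarterCos p σ (min 1 ((1 - t) / (b / (a + b)))))

/-- The first eigenvalue of `-Δ^{a,b}_p` on `(0, 1)`. -/
noncomputable def baseEigenvalue (p a b : ℝ) : ℝ := (p - 1) * ((a + b) * (piP p / 2)) ^ p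

theorem baseEigenvalue_pos (hp : 1 < p) (ha : 0 < a) (hb : 0 < b) : 0 < baseEigenvalue p a b := by
  have := piP_pos hp
  have : 0 < p - 1 := by linarith
  unfold baseEigenvalue
  positivity

/-- Reflection exchanges `a` and `b`, so only the increasing side of the arch needs computing. -/
theorem arch_symm (t : ℝ) : arch a b σ t = arch b a σ (1 - t) := by
  rw [arch, arch, min_comm, sub_sub_cancel, add_comm a b]

theorem archFlux_symm (t : ℝ) : archFlux p a b σ t = -archFlux p b a σ (1 - t) := by
  rw [archFlux, archFlux, sub_sub_cancel, add_comm a b]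
  ring

/-- To the left of the peak only one branch is active: the first quotient is the minimum in `arch`,
while the second is capped at `1` in `archFlux`, where `quarterCos` vanishes. -/
theorem min_arch_eq (ha : 0 < a) (hb : 0 < b) {t : ℝ} (ht : t ≤ a / (a + b)) :
    min (t / (a / (a + b))) ((1 - t) / (b / (a + b))) = t / (a / (a + b)) ∧
      1 ≤ (1 - t) / (b / (a + b)) ∧ t / (a / (a + b)) ≤ 1 := by
  have h1 : t / (a / (a + b)) ≤ 1 := (div_le_one (by positivity)).2 ht
  have h2 : 1 ≤ (1 - t) / (b / (a + b)) := by
    rw [one_le_div (by positivity)]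
    have : b / (a + b) = 1 - a / (a + b) := by field_simp; ring
    linarith
  exact ⟨min_eq_left (h1.trans h2), h2, h1⟩

theorem phiPlus_bump (ha : 0 < a) (hb : 0 < b) (t : ℝ) :
    phiPlus a b (bump σ) t = arch a b σ t := by
  have hab : 1 - tZero a b = b / (a + b) := by rw [tZero]; field_simp; ring
  rw [phiPlus, bump, bump]
  split_ifs with h
  · obtain ⟨e1, e2, e3⟩ := min_arch_eq ha hb (le_of_lt h)
    have e4 : 2 * (t / (2 * tZero a b)) = t / (a / (a + b)) := by
      rw [tZero]; field_simp
    rw [arch, e1, e4, min_eq_left (by linarith)]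
  · have h' : 1 - t ≤ b / (b + a) := by
      rw [add_comm b a, ← hab]; linarith
    obtain ⟨e1, e2, e3⟩ := min_arch_eq hb ha h'
    have e4 : 2 - 2 * ((t + 1 - 2 * tZero a b) / (2 * (1 - tZero a b)))
        = (1 - t) / (b / (b + a)) := by
      rw [hab, tZero]; field_simp; ring
    rw [arch_symm, arch, e1, e4, min_eq_right]
    linarith

theorem tZero_symm (ha : 0 < a) (hb : 0 < b) : 1 - tZero a b = tZero b a := by
  rw [tZero, tZero]; field_simp; ring

theorem phiMinus_eq_neg_phiPlus (ha : 0 < a) (hb : 0 < b) (φ : ℝ → ℝ) (t : ℝ) :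
    phiMinus a b φ t = -phiPlus b a φ t := by
  have h := tZero_symm ha hb
  have h' : tZero a b = 1 - tZero b a := by linarith
  rw [phiMinus, phiPlus, h, h']
  split_ifs
  · rfl
  · rw [show t + 2 * (1 - tZero b a) - 1 = t + 1 - 2 * tZero b a by ring]

theorem continuous_arch (hσ : IsQuarterSine p σ) : Continuous (arch a b σ) := by
  refine hσ.continuous.comp (Continuous.min ?_ ?_)
  · exact continuous_id.div_const _
  · exact (continuous_const.sub continuous_id).div_const _

theorem continuous_archFlux (hσ : IsQuarterSine p σ) (hp : 1 < p) :
    Continuous (archFlux p a b σ) := by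
  have h := hσ.continuous_cos hp
  refine continuous_const.mul ((continuous_const.mul (h.comp ?_)).sub
    (continuous_const.mul (h.comp ?_)))
  · exact continuous_const.min (continuous_id.div_const _)
  · exact continuous_const.min ((continuous_const.sub continuous_id).div_const _)

theorem arch_zero (hσ : IsQuarterSine p σ) (ha : 0 < a) (hb : 0 < b) : arch a b σ 0 = 0 := by
  rw [arch, (min_arch_eq ha hb (by positivity)).1, zero_div, hσ.map_zero]

theorem arch_one (hσ : IsQuarterSine p σ) (ha : 0 < a) (hb : 0 < b) : arch a b σ 1 = 0 := by
  rw [arch_symm, sub_self, arch_zero hσ hb ha]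

theorem archFlux_zero (hσ : IsQuarterSine p σ) (hp : 1 < p) (ha : 0 < a) (hb : 0 < b) :
    archFlux p a b σ 0 = ((a + b) * (piP p / 2)) ^ (p - 1) * a := by
  have := (min_arch_eq ha hb (t := 0) (by positivity)).2.1
  rw [archFlux, zero_div, min_eq_right zero_le_one, min_eq_left this, hσ.cos_zero hp,
    hσ.cos_one hp]
  ring

theorem archFlux_one :
    archFlux p a b σ 1 = -archFlux p b a σ 0 := by
  rw [archFlux_symm, sub_self]

theorem arch_pos (hσ : IsQuarterSine p σ) (ha : 0 < a) (hb : 0 < b) {t : ℝ}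
    (ht : t ∈ Ioo (0 : ℝ) 1) : 0 < arch a b σ t := by
  rw [arch, ← hσ.map_zero]
  refine hσ.strictMono (lt_min (div_pos ht.1 (by positivity)) (div_pos ?_ (by positivity)))
  linarith [ht.2]

theorem fluxInv_neg (w : ℝ) : fluxInv p a b (-w) = -fluxInv p b a w := apow_neg_eq

/-- The rising time `a / (a + b)` is what balances the two sides. With `h = piP p / 2`, the slope is
`(a + b) h / a` times `quarterCos ^ (1 / (p - 1))`, so its flux is `C * a * quarterCos`.
Differentiating produces `C * a / τ = C * (a + b)`, symmetric in `a` and `b`, so the increasing and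
decreasing sides share the same eigenvalue. -/
theorem hasDerivAt_arch_left (hσ : IsQuarterSine p σ) (hp : 1 < p) (ha : 0 < a) (hb : 0 < b)
    {t : ℝ} (ht0 : 0 < t) (ht : t < a / (a + b)) :
    HasDerivAt (arch a b σ) (fluxInv p a b (archFlux p a b σ t)) t ∧
      HasDerivAt (archFlux p a b σ) (-(baseEigenvalue p a b * apow (p - 1) 1 1 (arch a b σ t)))
        t := by
  have hp1 : 0 < p - 1 := by linarith
  have hpi := piP_pos hp
  set τ := a / (a + b) with hτ
  have hτ0 : 0 < τ := by positivity
  set h := piP p / 2 with hh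
  have hh0 : 0 < h := by positivity
  set C := ((a + b) * h) ^ (p - 1) with hC
  have hx : t / τ ∈ Ioo (0 : ℝ) 1 := ⟨by positivity, (div_lt_one hτ0).2 ht⟩
  have hev1 : arch a b σ =ᶠ[𝓝 t] fun t => σ (t / τ) := by
    filter_upwards [Iio_mem_nhds ht] with s hs
    rw [arch, (min_arch_eq ha hb (le_of_lt hs)).1]
  have hev2 : archFlux p a b σ =ᶠ[𝓝 t] fun t => C * a * quarterCos p σ (t / τ) := by
    filter_upwards [Iio_mem_nhds ht] with s hs
    obtain ⟨-, e2, e3⟩ := min_arch_eq ha hb (le_of_lt hs)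
    rw [archFlux, min_eq_left e2, min_eq_right e3, hσ.cos_one hp]
    ring
  have hdiv : HasDerivAt (fun t => t / τ) (1 / τ) t := (hasDerivAt_id t).div_const τ
  have d1 := (hσ.hasDerivAt _ hx).comp t hdiv
  have d2 := ((hσ.hasDerivAt_cos hp hx).comp t hdiv).const_mul (C * a)
  have hγ := hσ.cos_pos hp hx
  have hs0 := (hσ.mem_Ioo hx).1
  constructor
  · refine (d1.congr_of_eventuallyEq hev1).congr_deriv ?_
    -- The slope is written as `fluxInv` of its own flux, so it is enough to compare fluxes.
    rw [← fluxInv_flux hp ha hb (_ * (1 / τ)), hev2.eq_of_nhds]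
    congr 1
    rw [hσ.cos_rpow_inv hp hx, flux_eq_apow, apow_of_nonneg hp1 (by positivity)]
    have e1 : h * quarterCos p σ (t / τ) ^ (p - 1)⁻¹ * (1 / τ)
        = (a + b) * h * a⁻¹ * quarterCos p σ (t / τ) ^ (p - 1)⁻¹ := by
      rw [hτ]; field_simp
    rw [e1, Real.mul_rpow (by positivity) (by positivity),
      Real.mul_rpow (by positivity) (by positivity), Real.rpow_inv_rpow hγ.le hp1.ne', ← hC,
      Real.inv_rpow ha.le, Real.rpow_sub_one ha.ne']
    have : a ^ p ≠ 0 := (Real.rpow_pos_of_pos ha p).ne'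
    field_simp
  · refine (d2.congr_of_eventuallyEq hev2).congr_deriv ?_
    rw [hev1.eq_of_nhds, apow_of_nonneg hp1 hs0.le, baseEigenvalue, ← hh,
      show ((a + b) * h) ^ p = C * ((a + b) * h) by
        rw [hC, ← Real.rpow_add_one (by positivity)]; simp, hτ]
    field_simp

theorem hasDerivAt_arch (hσ : IsQuarterSine p σ) (hp : 1 < p) (ha : 0 < a) (hb : 0 < b)
    {t : ℝ} (ht : t ∈ Ioo (0 : ℝ) 1) (hne : t ≠ a / (a + b)) :
    HasDerivAt (arch a b σ) (fluxInv p a b (archFlux p a b σ t)) t ∧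
      HasDerivAt (archFlux p a b σ) (-(baseEigenvalue p a b * apow (p - 1) 1 1 (arch a b σ t)))
        t := by
  rcases lt_or_gt_of_ne hne with h | h
  · exact hasDerivAt_arch_left hσ hp ha hb ht.1 h
  · have h' : 1 - t < b / (b + a) := by
      have : b / (b + a) = 1 - a / (a + b) := by field_simp; ring
      linarith
    obtain ⟨d1, d2⟩ := hasDerivAt_arch_left hσ hp hb ha (by linarith [ht.2]) h'
    have hs : HasDerivAt (fun t : ℝ => 1 - t) (-1) t := (hasDerivAt_id t).const_sub 1
    constructor
    · have e : arch a b σ = arch b a σ ∘ fun t => 1 - t := funext fun t => arch_symm t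
      rw [archFlux_symm, fluxInv_neg, e]
      exact (d1.comp t hs).congr_deriv (by ring)
    · have e : archFlux p a b σ = fun t => -(archFlux p b a σ ∘ fun t => 1 - t) t :=
        funext fun t => archFlux_symm t
      rw [arch_symm, e]
      refine (d2.comp t hs).neg.congr_deriv ?_
      rw [baseEigenvalue, baseEigenvalue, add_comm a b]
      ring

/-- The `2`-periodic solution of the first-order system (first component). -/
noncomputable def wave (a b : ℝ) (σ : ℝ → ℝ) : ℝ → ℝ := phiPer a b (bump σ)

/-- The `2`-periodic solution of the first-order system (second component). -/
noncomputable def waveFlux (p a b : ℝ) (σ : ℝ → ℝ) (t : ℝ) : ℝ :=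
  if 2 * Int.fract (t / 2) < 1 then archFlux p a b σ (2 * Int.fract (t / 2))
  else -archFlux p b a σ (2 * Int.fract (t / 2) - 1)

theorem wave_eq (ha : 0 < a) (hb : 0 < b) (t : ℝ) : wave a b σ t =
    if 2 * Int.fract (t / 2) < 1 then arch a b σ (2 * Int.fract (t / 2))
    else -arch b a σ (2 * Int.fract (t / 2) - 1) := by
  rw [wave, phiPer, phiPlus_bump ha hb, phiMinus_eq_neg_phiPlus ha hb, phiPlus_bump hb ha]

theorem continuous_glue {f g : ℝ → ℝ} (hf : Continuous f) (hg : Continuous g)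
    (h1 : f 1 = g 0) (h2 : f 0 = g 1) : Continuous fun t : ℝ =>
      if 2 * Int.fract (t / 2) < 1 then f (2 * Int.fract (t / 2))
      else g (2 * Int.fract (t / 2) - 1) := by
  have hc : Continuous fun s : ℝ => if 1 ≤ 2 * s then g (2 * s - 1) else f (2 * s) := by
    refine Continuous.if_le (by fun_prop) (by fun_prop) (by fun_prop) (by fun_prop) fun s hs => ?_
    rw [← hs, sub_self, h1]
  have := (hc.continuousOn.comp_fract'' (by norm_num [h2])).comp (continuous_id.div_const 2)
  refine this.congr fun t => ?_
  simp only [Function.comp, id, ← not_le, ite_not]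

theorem continuous_wave (hσ : IsQuarterSine p σ) (ha : 0 < a) (hb : 0 < b) :
    Continuous (wave a b σ) := by
  refine (continuous_glue (continuous_arch hσ (a := a) (b := b))
    (continuous_arch hσ (a := b) (b := a)).neg ?_ ?_).congr fun t => (wave_eq ha hb t).symm
  · simp [arch_one hσ ha hb, arch_zero hσ hb ha]
  · simp [arch_zero hσ ha hb, arch_one hσ hb ha]

theorem continuous_waveFlux (hσ : IsQuarterSine p σ) (hp : 1 < p) :
    Continuous (waveFlux p a b σ) := by
  refine continuous_glue (continuous_archFlux hσ hp (a := a) (b := b))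
    (continuous_archFlux hσ hp (a := b) (b := a)).neg ?_ ?_
  · simp [archFlux_one (a := a) (b := b)]
  · simp [archFlux_one (a := b) (b := a)]

theorem countable_two_mul_fract (x : ℝ) : {t : ℝ | 2 * Int.fract (t / 2) = x}.Countable := by
  refine (countable_range fun n : ℤ => 2 * (n : ℝ) + x).mono ?_
  intro t ht
  have ht' : 2 * Int.fract (t / 2) = x := ht
  refine ⟨⌊t / 2⌋, ?_⟩
  have h1 := Int.floor_add_fract (t / 2)
  beta_reduce
  linarith

theorem hasDerivAt_glue {f g f' g' : ℝ → ℝ} {t : ℝ}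
    (hf : 2 * Int.fract (t / 2) ∈ Ioo (0 : ℝ) 1 →
      HasDerivAt f (f' (2 * Int.fract (t / 2))) (2 * Int.fract (t / 2)))
    (hg : 2 * Int.fract (t / 2) - 1 ∈ Ioo (0 : ℝ) 1 →
      HasDerivAt g (g' (2 * Int.fract (t / 2) - 1)) (2 * Int.fract (t / 2) - 1))
    (h0 : 2 * Int.fract (t / 2) ≠ 0) (h1 : 2 * Int.fract (t / 2) ≠ 1) :
    HasDerivAt (fun t : ℝ => if 2 * Int.fract (t / 2) < 1 then f (2 * Int.fract (t / 2))
      else g (2 * Int.fract (t / 2) - 1))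
      (if 2 * Int.fract (t / 2) < 1 then f' (2 * Int.fract (t / 2))
      else g' (2 * Int.fract (t / 2) - 1)) t := by
  set n : ℤ := ⌊t / 2⌋ with hn
  have hfr : 2 * Int.fract (t / 2) = t - 2 * n := by
    have := Int.floor_add_fract (t / 2)
    linarith
  have hnn : 0 ≤ 2 * Int.fract (t / 2) := mul_nonneg zero_le_two (Int.fract_nonneg _)
  have hlt : 2 * Int.fract (t / 2) < 2 := by linarith [Int.fract_lt_one (t / 2)]
  have hev : ∀ᶠ s : ℝ in 𝓝 t, 2 * Int.fract (s / 2) = s - 2 * n := by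
    have hmem : t ∈ Ioo (2 * (n : ℝ)) (2 * n + 2) :=
      ⟨by linarith [lt_of_le_of_ne hnn h0.symm], by linarith⟩
    filter_upwards [Ioo_mem_nhds hmem.1 hmem.2] with s hs
    have : ⌊s / 2⌋ = n := by
      rw [Int.floor_eq_iff]
      exact ⟨by linarith [hs.1], by linarith [hs.2]⟩
    have h3 := Int.floor_add_fract (s / 2)
    rw [this] at h3
    linarith
  rcases lt_or_gt_of_ne h1 with h | h
  · rw [if_pos h]
    have hd := hf ⟨lt_of_le_of_ne hnn h0.symm, h⟩
    rw [hfr] at hd ⊢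
    refine (hd.comp_sub_const t (2 * n)).congr_of_eventuallyEq ?_
    filter_upwards [hev, Iio_mem_nhds (show t < 2 * n + 1 by linarith)] with s hs hs'
    have : s < 2 * n + 1 := hs'
    rw [hs, if_pos (by linarith)]
  · rw [if_neg h.not_gt]
    have hd := hg ⟨by linarith, by linarith⟩
    rw [hfr, sub_sub] at hd ⊢
    refine (hd.comp_sub_const t (2 * n + 1)).congr_of_eventuallyEq ?_
    filter_upwards [hev, Ioi_mem_nhds (show 2 * n + 1 < t by linarith)] with s hs hs'
    have : 2 * n + 1 < s := hs'
    rw [hs, if_neg (by linarith), sub_sub]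

/-- A continuous candidate derivative makes `f` its primitive despite countably many exceptions.
This avoids matching one-sided derivatives at the zeros and extrema of the wave. -/
theorem hasDerivAt_of_off_countable {f f' : ℝ → ℝ} {s : Set ℝ} (hs : s.Countable)
    (hf : Continuous f) (hf' : Continuous f') (hd : ∀ t ∉ s, HasDerivAt f (f' t) t) (t : ℝ) :
    HasDerivAt f (f' t) t := by
  have h : f = fun t => f 0 + ∫ s in (0 : ℝ)..t, f' s := by
    funext x
    rw [integral_eq_of_hasDerivAt_off_countable f f' hs hf.continuousOn (fun x hx => hd x hx.2)
      (hf'.intervalIntegrable _ _)]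
    ring
  rw [h]
  exact (hf'.integral_hasStrictDerivAt 0 t).hasDerivAt.const_add _

theorem isSystemSol_wave (hσ : IsQuarterSine p σ) (hp : 1 < p) (ha : 0 < a) (hb : 0 < b) :
    IsSystemSol p a b (baseEigenvalue p a b) (wave a b σ) (waveFlux p a b σ) univ := by
  -- These are the even and odd integers, where the arches meet, and the extrema of the positive and
  -- negative arches.
  set S : Set ℝ := {t | 2 * Int.fract (t / 2) = 0} ∪ {t | 2 * Int.fract (t / 2) = 1} ∪
    {t | 2 * Int.fract (t / 2) = a / (a + b)} ∪
    {t | 2 * Int.fract (t / 2) = b / (b + a) + 1} with hS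
  have hSc : S.Countable := (((countable_two_mul_fract _).union (countable_two_mul_fract _)).union
    (countable_two_mul_fract _)).union (countable_two_mul_fract _)
  have hcw := continuous_wave hσ ha hb
  have hcf := continuous_waveFlux hσ hp (a := a) (b := b)
  have hbase : baseEigenvalue p b a = baseEigenvalue p a b := by
    rw [baseEigenvalue, baseEigenvalue, add_comm]
  have key : ∀ t ∉ S, HasDerivAt (wave a b σ) (fluxInv p a b (waveFlux p a b σ t)) t ∧
      HasDerivAt (waveFlux p a b σ)
        (-(baseEigenvalue p a b * apow (p - 1) 1 1 (wave a b σ t))) t := by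
    intro t ht
    simp only [hS, mem_union, mem_ofPred_eq, not_or] at ht
    obtain ⟨⟨⟨n0, n1⟩, n2⟩, n3⟩ := ht
    have n3' : 2 * Int.fract (t / 2) - 1 ≠ b / (b + a) := fun h => n3 (by linarith)
    have ew : wave a b σ = fun t => if 2 * Int.fract (t / 2) < 1
        then arch a b σ (2 * Int.fract (t / 2))
        else -arch b a σ (2 * Int.fract (t / 2) - 1) := funext fun t => wave_eq ha hb t
    constructor
    · have h := hasDerivAt_glue (t := t) (f := arch a b σ) (g := fun t => -arch b a σ t)
        (f' := fun t => fluxInv p a b (archFlux p a b σ t))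
        (g' := fun t => -fluxInv p b a (archFlux p b a σ t))
        (fun h => (hasDerivAt_arch hσ hp ha hb h n2).1)
        (fun h => (hasDerivAt_arch hσ hp hb ha h n3').1.neg) n0 n1
      rw [ew]
      refine h.congr_deriv ?_
      rw [waveFlux]
      split_ifs
      · rfl
      · rw [fluxInv_neg]
    · have h := hasDerivAt_glue (t := t) (f := archFlux p a b σ)
        (g := fun t => -archFlux p b a σ t)
        (f' := fun t => -(baseEigenvalue p a b * apow (p - 1) 1 1 (arch a b σ t)))
        (g' := fun t => -(-(baseEigenvalue p b a * apow (p - 1) 1 1 (arch b a σ t))))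
        (fun h => (hasDerivAt_arch hσ hp ha hb h n2).2)
        (fun h => (hasDerivAt_arch hσ hp hb ha h n3').2.neg) n0 n1
      refine HasDerivAt.congr_deriv (f := waveFlux p a b σ) h ?_
      rw [wave_eq ha hb]
      split_ifs
      · rfl
      · rw [apow_neg_eq, hbase]
        ring
  intro t _
  exact ⟨hasDerivAt_of_off_countable hSc hcw ((continuous_fluxInv hp).comp hcf)
      (fun t ht => (key t ht).1) t,
    hasDerivAt_of_off_countable hSc hcf
      (continuous_const.mul ((continuous_apow (by linarith)).comp hcw)).neg
      (fun t ht => (key t ht).2) t⟩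

theorem wave_eq_zero_iff (hσ : IsQuarterSine p σ) (ha : 0 < a) (hb : 0 < b) {t : ℝ} :
    wave a b σ t = 0 ↔ ∃ n : ℤ, t = n := by
  have hfl := Int.floor_add_fract (t / 2)
  have hnn := Int.fract_nonneg (t / 2)
  have hlt := Int.fract_lt_one (t / 2)
  rw [wave_eq ha hb]
  constructor
  · intro h
    split_ifs at h with h1
    · refine ⟨2 * ⌊t / 2⌋, ?_⟩
      push_cast
      by_contra hne
      refine (arch_pos hσ ha hb (t := 2 * Int.fract (t / 2)) ⟨?_, h1⟩).ne' h
      exact lt_of_le_of_ne (by linarith) fun h0 => hne (by linarith)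
    · refine ⟨2 * ⌊t / 2⌋ + 1, ?_⟩
      push_cast
      by_contra hne
      refine (arch_pos hσ hb ha (t := 2 * Int.fract (t / 2) - 1) ⟨?_, by linarith⟩).ne'
        (neg_eq_zero.1 h)
      exact lt_of_le_of_ne (by linarith) fun h0 => hne (by linarith)
  · rintro ⟨n, rfl⟩
    rcases Int.even_or_odd' n with ⟨m, rfl | rfl⟩
    · have : Int.fract (((2 * m : ℤ) : ℝ) / 2) = 0 := by
        push_cast
        rw [mul_div_cancel_left₀ _ two_ne_zero, Int.fract_intCast]
      rw [this, mul_zero, if_pos zero_lt_one, arch_zero hσ ha hb]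
    · have : Int.fract (((2 * m + 1 : ℤ) : ℝ) / 2) = 1 / 2 := by
        push_cast
        rw [add_div, mul_div_cancel_left₀ _ two_ne_zero, Int.fract_intCast_add]
        rw [Int.fract_eq_self]
        norm_num
      rw [this, if_neg (by norm_num), mul_one_div_cancel two_ne_zero, sub_self,
        arch_zero hσ hb ha, neg_zero]

theorem waveFlux_zero_pos (hσ : IsQuarterSine p σ) (hp : 1 < p) (ha : 0 < a) (hb : 0 < b) :
    0 < waveFlux p a b σ 0 := by
  have := piP_pos hp
  simp only [waveFlux, zero_div, Int.fract_zero, mul_zero, zero_lt_one, if_true]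
  rw [archFlux_zero hσ hp ha hb]
  positivity

/-- Amplitudes are positive, so each sign of the initial flux needs its own phase: `0` for positive
and `-1` for negative. -/
theorem waveFlux_neg_one_neg (hσ : IsQuarterSine p σ) (hp : 1 < p) (ha : 0 < a) (hb : 0 < b) :
    waveFlux p a b σ (-1) < 0 := by
  have := piP_pos hp
  have h : Int.fract ((-1 : ℝ) / 2) = 1 / 2 := by
    rw [show ((-1 : ℝ) / 2) = ((-1 : ℤ) : ℝ) + 1 / 2 by norm_num, Int.fract_intCast_add,
      Int.fract_eq_self]
    norm_num
  rw [waveFlux, h, if_neg (by norm_num), mul_one_div_cancel two_ne_zero, sub_self,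
    archFlux_zero hσ hp hb ha, neg_lt_zero]
  positivity

theorem wave_of_mem (ha : 0 < a) (hb : 0 < b) {t : ℝ} (ht : t ∈ Ico (0 : ℝ) 1) :
    wave a b σ t = arch a b σ t := by
  have : Int.fract (t / 2) = t / 2 :=
    Int.fract_eq_self.2 ⟨by linarith [ht.1], by linarith [ht.2]⟩
  rw [wave_eq ha hb, this, mul_div_cancel₀ _ two_ne_zero, if_pos ht.2]

/-- The flux scales like `(c κ) ^ (p - 1)`; one more `κ` from differentiating it leaves `c ^ (p - 1)
* κ ^ p`, and `c ^ (p - 1)` is absorbed by `|U|^(p-2) U`. -/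
theorem isSystemSol_wave_rescale (hσ : IsQuarterSine p σ) (hp : 1 < p) (ha : 0 < a) (hb : 0 < b)
    {c κ : ℝ} (hc : 0 < c) (hκ : 0 < κ) (s : ℝ) :
    IsSystemSol p a b (κ ^ p * baseEigenvalue p a b) (fun t => c * wave a b σ (κ * t + s))
      (fun t => (c * κ) ^ (p - 1) * waveFlux p a b σ (κ * t + s)) univ := by
  intro t _
  obtain ⟨h1, h2⟩ := isSystemSol_wave hσ hp ha hb (κ * t + s) trivial
  have hl : HasDerivAt (fun t => κ * t + s) κ t := by
    simpa using ((hasDerivAt_id t).const_mul κ).add_const s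
  constructor
  · refine ((h1.comp t hl).const_mul c).congr_deriv ?_
    rw [fluxInv_pos_mul hp (by positivity)]
    ring
  · refine ((h2.comp t hl).const_mul ((c * κ) ^ (p - 1))).congr_deriv ?_
    rw [apow_pos_mul hc, Real.mul_rpow hc.le hκ.le, show κ ^ p = κ ^ (p - 1) * κ by
      rw [← Real.rpow_add_one hκ.ne']; simp]
    ring

end reference

/-! ### Classification of the eigenfunctions -/

section classification

variable {p a b L lam : ℝ} {σ u : ℝ → ℝ}

theorem not_ae_false_Ioo (hL : 0 < L) : ¬ ∀ᵐ _ ∂(volume.restrict (Ioo 0 L)), False := by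
  rw [ae_iff]
  simp [hL]

theorem isEigenfunction_of_ae_eq_wave (hσ : IsQuarterSine p σ) (hp : 1 < p) (ha : 0 < a)
    (hb : 0 < b) (hL : 0 < L) {k : ℕ} (hk : 1 ≤ k) {c : ℝ} (hc : 0 < c) (s : ℤ)
    (hu : ∀ᵐ t ∂(volume.restrict (Ioo 0 L)), u t = c * wave a b σ (k / L * t + s)) :
    IsEigenfunction p a b L ((k / L) ^ p * baseEigenvalue p a b) u := by
  have hk0 : (0 : ℝ) < k := by exact_mod_cast hk
  refine ⟨(isWeakSolution_iff hp ha hb hL).2 ⟨_, _, fun t _ => isSystemSol_wave_rescale hσ hp ha hb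
    hc (κ := k / L) (by positivity) s t trivial, ?_, ?_, hu⟩, fun h0 => ?_⟩
  · rw [(wave_eq_zero_iff hσ ha hb).2 ⟨s, by simp⟩, mul_zero]
  · rw [(wave_eq_zero_iff hσ ha hb).2 ⟨k + s, by field_simp; push_cast; ring⟩, mul_zero]
  · have hz : (fun t => c * wave a b σ (k / L * t + s)) =ᵐ[volume.restrict (Ioo 0 L)]
        fun _ => 0 := by
      filter_upwards [hu, h0] with t h1 h2
      rw [← h1, h2]
    have hcw := continuous_wave hσ ha hb
    have hz' := Measure.eqOn_open_of_ae_eq hz isOpen_Ioo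
      (continuous_const.mul (hcw.comp (by fun_prop))).continuousOn continuousOn_const
    -- At this point the argument of the wave is the half-integer `s + 1 / 2`, which is not a zero.
    have hmem : L / (2 * k) ∈ Ioo 0 L := by
      refine ⟨by positivity, ?_⟩
      rw [div_lt_iff₀ (by positivity)]
      have : (1 : ℝ) ≤ k := by exact_mod_cast hk
      nlinarith
    have h1 := (mul_eq_zero.1 (hz' hmem)).resolve_left hc.ne'
    obtain ⟨n, hn⟩ := (wave_eq_zero_iff hσ ha hb).1 h1
    have h2 : (k : ℝ) / L * (L / (2 * k)) = 1 / 2 := by field_simp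
    rw [h2] at hn
    have h3 : (1 : ℝ) = ((2 * (n - s) : ℤ) : ℝ) := by push_cast; linarith
    have h4 : (1 : ℤ) = 2 * (n - s) := by exact_mod_cast h3
    omega

theorem exists_eq_wave_of_isSystemSol (hσ : IsQuarterSine p σ) (hp : 1 < p) (ha : 0 < a)
    (hb : 0 < b) (hL : 0 < L) {U W : ℝ → ℝ} (h : IsSystemSol p a b lam U W (Icc 0 L))
    (h0 : U 0 = 0) (hUL : U L = 0) (hlam : 0 < lam) {s : ℤ}
    (hs : 0 < W 0 / waveFlux p a b σ s) :
    ∃ k : ℤ, 1 ≤ k ∧ lam = (k / L) ^ p * baseEigenvalue p a b ∧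
      ∃ c : ℝ, 0 < c ∧ ∀ t ∈ Icc 0 L, U t = c * wave a b σ (k / L * t + s) := by
  have hbase := baseEigenvalue_pos hp ha hb
  have hp0 : p ≠ 0 := by linarith
  have hp1 : p - 1 ≠ 0 := by linarith
  -- The frequency is chosen to match `lam`, and the amplitude below to match `W 0`. Uniqueness then
  -- applies, and the zero at `L` makes `κ * L + s` an integer.
  set κ : ℝ := (lam / baseEigenvalue p a b) ^ p⁻¹ with hκ
  have hκ0 : 0 < κ := by positivity
  have hκp : κ ^ p * baseEigenvalue p a b = lam := by
    rw [hκ, Real.rpow_inv_rpow (by positivity) hp0, div_mul_cancel₀ _ hbase.ne']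
  set c : ℝ := (W 0 / waveFlux p a b σ s) ^ (p - 1)⁻¹ / κ with hc
  have hc0 : 0 < c := by positivity
  have hcκ : (c * κ) ^ (p - 1) = W 0 / waveFlux p a b σ s := by
    rw [hc, div_mul_cancel₀ _ hκ0.ne', Real.rpow_inv_rpow hs.le hp1]
  have hfs : waveFlux p a b σ s ≠ 0 := fun hz => by simp [hz] at hs
  have hW0 : W 0 ≠ 0 := fun hz => by simp [hz] at hs
  have href := isSystemSol_wave_rescale hσ hp ha hb hc0 hκ0 s
  rw [hκp] at href
  have heq := h.eqOn hp ha hb hlam (fun t _ => href t trivial)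
    (by rw [h0, mul_zero, zero_add, (wave_eq_zero_iff hσ ha hb).2 ⟨s, rfl⟩, mul_zero])
    (by rw [hcκ, mul_zero, zero_add, div_mul_cancel₀ _ hfs]) (Or.inr hW0)
  have hend := heq (right_mem_Icc.2 hL.le)
  rw [hUL] at hend
  obtain ⟨n, hn⟩ := (wave_eq_zero_iff hσ ha hb).1
    ((mul_eq_zero.1 hend.symm).resolve_left hc0.ne')
  have hκL : κ = ((n - s : ℤ) : ℝ) / L := by
    rw [eq_div_iff hL.ne']
    push_cast
    linarith
  refine ⟨n - s, ?_, by rw [← hκL, hκp], c, hc0, fun t ht => by rw [← hκL]; exact heq ht⟩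
  have h1 : (0 : ℝ) < ((n - s : ℤ) : ℝ) := by
    have : ((n - s : ℤ) : ℝ) = κ * L := by rw [hκL, div_mul_cancel₀ _ hL.ne']
    rw [this]
    positivity
  have h2 : 0 < n - s := by exact_mod_cast h1
  omega

theorem isEigenfunction_iff (hσ : IsQuarterSine p σ) (hp : 1 < p) (ha : 0 < a) (hb : 0 < b)
    (hL : 0 < L) : IsEigenfunction p a b L lam u ↔
      ∃ k : ℕ, 1 ≤ k ∧ lam = (k / L) ^ p * baseEigenvalue p a b ∧ ∃ c : ℝ, 0 < c ∧
        ((∀ᵐ t ∂(volume.restrict (Ioo 0 L)), u t = c * wave a b σ (k * t / L)) ∨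
          ∀ᵐ t ∂(volume.restrict (Ioo 0 L)), u t = c * wave a b σ (k * t / L - 1)) := by
  constructor
  · rintro ⟨hw, hne⟩
    obtain ⟨U, W, hsol, h0, hUL, huU⟩ := (isWeakSolution_iff hp ha hb hL).1 hw
    have hU : ∃ t ∈ Icc 0 L, U t ≠ 0 := by
      by_contra! hz
      refine hne ?_
      filter_upwards [huU, ae_restrict_mem measurableSet_Ioo] with t h1 h2
      rw [h1, hz t (Ioo_subset_Icc_self h2)]
    have hlam := hsol.lam_pos hp ha hb h0 hUL hU
    -- Otherwise the trajectory would start at the origin and have zero energy throughout.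
    have hW0 : W 0 ≠ 0 := by
      intro hW0
      obtain ⟨t, ht, hUt⟩ := hU
      have e1 := hsol.energy_eq hp ht
      rw [h0, hW0, energy_zero hp] at e1
      exact (energy_pos hp ha hb hlam (Or.inl hUt)).ne' e1
    have key : ∀ s : ℤ, 0 < W 0 / waveFlux p a b σ s → ∃ k : ℕ, 1 ≤ k ∧
        lam = (k / L) ^ p * baseEigenvalue p a b ∧ ∃ c : ℝ, 0 < c ∧
          ∀ᵐ t ∂(volume.restrict (Ioo 0 L)), u t = c * wave a b σ (k * t / L + s) := by
      intro s hs
      obtain ⟨k, hk, hl, c, hc, hUk⟩ :=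
        exists_eq_wave_of_isSystemSol hσ hp ha hb hL hsol h0 hUL hlam hs
      lift k to ℕ using by omega
      refine ⟨k, by exact_mod_cast hk, by exact_mod_cast hl, c, hc, ?_⟩
      filter_upwards [huU, ae_restrict_mem measurableSet_Ioo] with t h1 h2
      rw [h1, hUk t (Ioo_subset_Icc_self h2), Int.cast_natCast, div_mul_eq_mul_div]
    rcases lt_or_gt_of_ne hW0 with hneg | hpos
    · obtain ⟨k, hk, hl, c, hc, hu⟩ := key (-1) (div_pos_of_neg_of_neg hneg
        (by simpa using waveFlux_neg_one_neg hσ hp ha hb))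
      refine ⟨k, hk, hl, c, hc, Or.inr ?_⟩
      simpa [← sub_eq_add_neg] using hu
    · obtain ⟨k, hk, hl, c, hc, hu⟩ := key 0 (div_pos hpos
        (by simpa using waveFlux_zero_pos hσ hp ha hb))
      refine ⟨k, hk, hl, c, hc, Or.inl ?_⟩
      simpa using hu
  · rintro ⟨k, hk, rfl, c, hc, hu | hu⟩
    · refine isEigenfunction_of_ae_eq_wave hσ hp ha hb hL hk hc 0 ?_
      simpa [div_mul_eq_mul_div] using hu
    · refine isEigenfunction_of_ae_eq_wave hσ hp ha hb hL hk hc (-1) ?_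
      simpa [div_mul_eq_mul_div, ← sub_eq_add_neg] using hu

theorem mul_lambda1_eq (hp : 1 < p) (ha : 0 < a) (hb : 0 < b) (hL : 0 < L) (k : ℕ) :
    ((k : ℝ) * (a + b) / 2) ^ p * lambda1 p L = (k / L) ^ p * baseEigenvalue p a b := by
  have hpi := piP_pos hp
  have e : ((k : ℝ) * (a + b) / 2) ^ p * (piP p / L) ^ p
      = (k / L) ^ p * ((a + b) * (piP p / 2)) ^ p := by
    rw [← Real.mul_rpow (by positivity) (by positivity),
      ← Real.mul_rpow (by positivity) (by positivity)]
    congr 1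
    field_simp
  rw [lambda1, baseEigenvalue]
  linear_combination (p - 1) * e

theorem dirichletSpectrum_eq (hp : 1 < p) (ha : 0 < a) (hb : 0 < b) (hL : 0 < L) :
    dirichletSpectrum p a b L
      = {lam : ℝ | ∃ k : ℕ, 1 ≤ k ∧ lam = ((k : ℝ) * (a + b) / 2) ^ p * lambda1 p L} := by
  obtain ⟨σ, hσ⟩ := exists_isQuarterSine hp
  ext lam
  constructor
  · rintro ⟨u, hu⟩
    obtain ⟨k, hk, hl, -⟩ := (isEigenfunction_iff hσ hp ha hb hL).1 hu
    exact ⟨k, hk, by rw [mul_lambda1_eq hp ha hb hL, hl]⟩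
  · rintro ⟨k, hk, rfl⟩
    exact ⟨_, (isEigenfunction_iff hσ hp ha hb hL).2 ⟨k, hk, mul_lambda1_eq hp ha hb hL k, 1,
      one_pos, Or.inl (Eventually.of_forall fun _ => rfl)⟩⟩

/-- Distinct `k` give distinct eigenvalues, so fixing the eigenvalue fixes the frequency of the
wave. -/
theorem isEigenfunction_mul_lambda1_iff (hσ : IsQuarterSine p σ) (hp : 1 < p) (ha : 0 < a)
    (hb : 0 < b) (hL : 0 < L) {k : ℕ} (hk : 1 ≤ k) :
    IsEigenfunction p a b L (((k : ℝ) * (a + b) / 2) ^ p * lambda1 p L) u ↔ ∃ c : ℝ, 0 < c ∧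
      ((∀ᵐ t ∂(volume.restrict (Ioo 0 L)), u t = c * wave a b σ (k * t / L)) ∨
        ∀ᵐ t ∂(volume.restrict (Ioo 0 L)), u t = c * wave a b σ (k * t / L - 1)) := by
  rw [mul_lambda1_eq hp ha hb hL, isEigenfunction_iff hσ hp ha hb hL]
  constructor
  · rintro ⟨m, hm, hl, h⟩
    have h1 := mul_right_cancel₀ (baseEigenvalue_pos hp ha hb).ne' hl
    have h2 := (Real.rpow_left_inj (by positivity) (by positivity) (by linarith)).1 h1
    have h3 : (k : ℝ) = m := by
      field_simp at h2
      exact h2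
    obtain rfl : k = m := by exact_mod_cast h3
    exact h
  · exact fun h => ⟨k, hk, rfl, h⟩

end classification

/-! ### The principal eigenfunction -/

section principal

variable {p a b : ℝ} {σ φ : ℝ → ℝ}

theorem arch_one_one (t : ℝ) : arch 1 1 σ t = bump σ t := by
  rw [arch, bump]
  congr 2 <;> ring

theorem wave_sub_one_of_mem (ha : 0 < a) (hb : 0 < b) {t : ℝ} (ht : t ∈ Ico (0 : ℝ) 1) :
    wave a b σ (t - 1) = -arch b a σ t := by
  have : Int.fract ((t - 1) / 2) = (t + 1) / 2 := by
    rw [show (t - 1) / 2 = (t + 1) / 2 + ((-1 : ℤ) : ℝ) by push_cast; ring,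
      Int.fract_add_intCast, Int.fract_eq_self]
    exact ⟨by linarith [ht.1], by linarith [ht.2]⟩
  rw [wave_eq ha hb, this, mul_div_cancel₀ _ two_ne_zero, if_neg (by linarith [ht.1]),
    add_sub_cancel_right]

theorem bump_pos (hσ : IsQuarterSine p σ) {t : ℝ} (ht : t ∈ Ioo (0 : ℝ) 1) : 0 < bump σ t := by
  rw [← arch_one_one]
  exact arch_pos hσ one_pos one_pos ht

theorem continuous_bump (hσ : IsQuarterSine p σ) : Continuous (bump σ) := by
  have := continuous_arch hσ (a := 1) (b := 1)
  exact this.congr arch_one_one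

theorem lpNorm_bump_ne_top (hσ : IsQuarterSine p σ) : lpNormInterval p 1 (bump σ) ≠ ⊤ :=
  (memLpInterval_of_continuous (continuous_bump hσ)).eLpNorm_ne_top

theorem lpNorm_bump_ne_zero (hσ : IsQuarterSine p σ) (hp : 1 < p) :
    lpNormInterval p 1 (bump σ) ≠ 0 := by
  intro h
  have h1 := (eLpNorm_eq_zero_iff (continuous_bump hσ).aestronglyMeasurable
    (by simpa using by linarith)).1 h
  have h2 : ∀ᵐ t ∂(volume.restrict (Ioo (0 : ℝ) 1)), False := by
    filter_upwards [h1, ae_restrict_mem measurableSet_Ioo] with t h1 h2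
    exact (bump_pos hσ h2).ne' h1
  exact not_ae_false_Ioo one_pos h2

theorem isEigenfunction_one_iff (hσ : IsQuarterSine p σ) (hp : 1 < p) :
    IsEigenfunction p 1 1 1 (lambda1 p 1) φ ↔ ∃ c : ℝ, 0 < c ∧
      ((∀ᵐ t ∂(volume.restrict (Ioo (0 : ℝ) 1)), φ t = c * bump σ t) ∨
        ∀ᵐ t ∂(volume.restrict (Ioo (0 : ℝ) 1)), φ t = -(c * bump σ t)) := by
  have h := isEigenfunction_mul_lambda1_iff (u := φ) hσ hp one_pos one_pos one_pos le_rfl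
  have e : (((1 : ℕ) : ℝ) * (1 + 1) / 2) ^ p * lambda1 p 1 = lambda1 p 1 := by norm_num
  rw [e] at h
  rw [h]
  refine exists_congr fun c => and_congr_right fun _ => or_congr ?_ ?_
  · refine eventually_congr ?_
    filter_upwards [ae_restrict_mem measurableSet_Ioo] with t ht
    rw [Nat.cast_one, one_mul, div_one, wave_of_mem one_pos one_pos (Ioo_subset_Ico_self ht),
      arch_one_one]
  · refine eventually_congr ?_
    filter_upwards [ae_restrict_mem measurableSet_Ioo] with t ht
    rw [Nat.cast_one, one_mul, div_one, wave_sub_one_of_mem one_pos one_pos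
      (Ioo_subset_Ico_self ht), arch_one_one, mul_neg]

theorem lpNorm_const_mul {c : ℝ} (hc : 0 < c) (f : ℝ → ℝ) :
    lpNormInterval p 1 (fun t => c * f t) = ENNReal.ofReal c * lpNormInterval p 1 f := by
  rw [lpNormInterval, ← Real.enorm_of_nonneg hc.le]
  exact eLpNorm_const_smul c f _ _

/-- The eigenfunctions for this eigenvalue are the nonzero multiples of the bump: positivity selects
the sign and the norm selects the constant. -/
theorem isPrincipal_iff (hσ : IsQuarterSine p σ) (hp : 1 < p) :
    IsPrincipal p φ ↔ ∀ᵐ t ∂(volume.restrict (Ioo (0 : ℝ) 1)),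
      φ t = (lpNormInterval p 1 (bump σ)).toReal⁻¹ * bump σ t := by
  set N := lpNormInterval p 1 (bump σ) with hN
  have hNt : N ≠ ⊤ := lpNorm_bump_ne_top hσ
  have hN0 : N ≠ 0 := lpNorm_bump_ne_zero hσ hp
  have hNr : 0 < N.toReal := ENNReal.toReal_pos hN0 hNt
  have hnorm : ∀ {c : ℝ}, 0 < c → (∀ᵐ t ∂(volume.restrict (Ioo (0 : ℝ) 1)),
      φ t = c * bump σ t) → lpNormInterval p 1 φ = ENNReal.ofReal (c * N.toReal) := by
    intro c hc h
    have : lpNormInterval p 1 φ = lpNormInterval p 1 fun t => c * bump σ t := eLpNorm_congr_ae h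
    rw [this, lpNorm_const_mul hc, ENNReal.ofReal_mul hc.le, ENNReal.ofReal_toReal hNt]
  constructor
  · rintro ⟨h1, h2, h3⟩
    obtain ⟨c, hc, h | h⟩ := (isEigenfunction_one_iff hσ hp).1 h1
    · rw [hnorm hc h, ENNReal.ofReal_eq_one] at h3
      rwa [eq_inv_of_mul_eq_one_left h3] at h
    · have h4 : ∀ᵐ t ∂(volume.restrict (Ioo (0 : ℝ) 1)), False := by
        filter_upwards [h, h2, ae_restrict_mem measurableSet_Ioo] with t e1 e2 e3
        have := mul_pos hc (bump_pos hσ e3)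
        linarith
      exact (not_ae_false_Ioo one_pos h4).elim
  · intro h
    refine ⟨(isEigenfunction_one_iff hσ hp).2 ⟨_, by positivity, Or.inl h⟩, ?_, ?_⟩
    · filter_upwards [h, ae_restrict_mem measurableSet_Ioo] with t e1 e2
      rw [e1]
      exact mul_pos (by positivity) (bump_pos hσ e2)
    · rw [hnorm (by positivity) h, inv_mul_cancel₀ hNr.ne', ENNReal.ofReal_one]

/-- The principal eigenfunction is determined only almost everywhere, so identities for it have to
be carried through the affine substitutions inside `phiPer`. -/
theorem ae_comp_affine {P : ℝ → Prop} (h : ∀ᵐ x, P x) {α : ℝ} (hα : α ≠ 0) (β : ℝ) :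
    ∀ᵐ t, P (α * t + β) := by
  rw [ae_iff] at h ⊢
  have : {t | ¬P (α * t + β)} = (α * ·) ⁻¹' ((· + β) ⁻¹' {x | ¬P x}) := rfl
  rw [this, Real.volume_preimage_mul_left hα, measure_preimage_add_right, h, mul_zero]

theorem phiPlus_ae_eq (ha : 0 < a) (hb : 0 < b) {χ : ℝ → ℝ} {c : ℝ}
    (h : ∀ᵐ x, x ∈ Ioo (0 : ℝ) 1 → φ x = c * χ x) :
    ∀ᵐ t, t ∈ Ioo (0 : ℝ) 1 → phiPlus a b φ t = c * phiPlus a b χ t := by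
  have ht0 : 0 < tZero a b := by unfold tZero; positivity
  have ht1 : 0 < 1 - tZero a b := by
    rw [tZero_symm ha hb]; unfold tZero; positivity
  filter_upwards [ae_comp_affine h (α := 1 / (2 * tZero a b)) (by positivity) 0,
    ae_comp_affine h (α := 1 / (2 * (1 - tZero a b))) (by positivity)
      ((1 - 2 * tZero a b) / (2 * (1 - tZero a b)))] with t h1 h2 ht
  rw [phiPlus, phiPlus]
  split_ifs with hlt
  · have e : 1 / (2 * tZero a b) * t + 0 = t / (2 * tZero a b) := by ring
    rw [e] at h1
    refine h1 ⟨div_pos ht.1 (by positivity), ?_⟩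
    rw [div_lt_one (by positivity)]
    linarith
  · have e : 1 / (2 * (1 - tZero a b)) * t + (1 - 2 * tZero a b) / (2 * (1 - tZero a b))
        = (t + 1 - 2 * tZero a b) / (2 * (1 - tZero a b)) := by ring
    rw [e] at h2
    refine h2 ⟨div_pos (by linarith) (by positivity), ?_⟩
    rw [div_lt_one (by positivity)]
    linarith [ht.2]

theorem phiPer_ae_eq (ha : 0 < a) (hb : 0 < b) {χ : ℝ → ℝ} {c : ℝ}
    (h : ∀ᵐ x, x ∈ Ioo (0 : ℝ) 1 → φ x = c * χ x) :
    ∀ᵐ t, phiPer a b φ t = c * phiPer a b χ t := by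
  -- All translates are handled on one set of full measure, so that `n` may later be the floor of `t
  -- / 2`, which depends on `t`.
  have h1 : ∀ᵐ t : ℝ, ∀ n : ℤ, t - 2 * n ∈ Ioo (0 : ℝ) 1 →
      phiPlus a b φ (t - 2 * n) = c * phiPlus a b χ (t - 2 * n) := by
    refine ae_all_iff.2 fun n => ?_
    have := ae_comp_affine (phiPlus_ae_eq ha hb h) one_ne_zero (-(2 * n))
    simpa only [one_mul, ← sub_eq_add_neg] using this
  have h2 : ∀ᵐ t : ℝ, ∀ n : ℤ, t - 2 * n - 1 ∈ Ioo (0 : ℝ) 1 →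
      phiPlus b a φ (t - 2 * n - 1) = c * phiPlus b a χ (t - 2 * n - 1) := by
    refine ae_all_iff.2 fun n => ?_
    have := ae_comp_affine (phiPlus_ae_eq hb ha h) one_ne_zero (-(2 * n + 1))
    simpa only [one_mul, ← sub_eq_add_neg, ← sub_sub] using this
  -- The junctions, where `φ` would be evaluated at an endpoint of `(0, 1)`, form a null set.
  have h3 : ∀ x : ℝ, ∀ᵐ t : ℝ, 2 * Int.fract (t / 2) ≠ x := fun x =>
    (countable_two_mul_fract x).ae_notMem volume
  filter_upwards [h1, h2, h3 0, h3 1] with t h1 h2 n0 n1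
  have hfr : 2 * Int.fract (t / 2) = t - 2 * ⌊t / 2⌋ := by
    have := Int.floor_add_fract (t / 2)
    linarith
  have hnn : 0 < 2 * Int.fract (t / 2) :=
    lt_of_le_of_ne (mul_nonneg zero_le_two (Int.fract_nonneg _)) n0.symm
  have hlt : 2 * Int.fract (t / 2) < 2 := by linarith [Int.fract_lt_one (t / 2)]
  have h1' := h1 ⌊t / 2⌋
  have h2' := h2 ⌊t / 2⌋
  rw [← hfr] at h1' h2'
  rw [phiPer, phiPer]
  split_ifs with h
  · exact h1' ⟨hnn, h⟩
  · rw [phiMinus_eq_neg_phiPlus ha hb, phiMinus_eq_neg_phiPlus ha hb, mul_neg, neg_inj]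
    exact h2' ⟨by linarith [lt_of_le_of_ne (not_lt.1 h) n1.symm], by linarith⟩

end principal

end AsymPLap

/-! ### The main theorem. -/

theorem theorem2 (p a b L : ℝ) (hp : 1 < p) (ha : 0 < a) (hb : 0 < b) (hL : 0 < L) :
    (AsymPLap.dirichletSpectrum p a b L
        = (fun lam : ℝ => ((a + b) / 2) ^ p * lam) '' AsymPLap.pSpectrum p L ∧
      AsymPLap.dirichletSpectrum p a b L
        = {lam : ℝ | ∃ k : ℕ, 1 ≤ k ∧
            lam = ((k : ℝ) * (a + b) / 2) ^ p * AsymPLap.lambda1 p L}) ∧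
    ((∃ φ : ℝ → ℝ, AsymPLap.IsPrincipal p φ) ∧
      ∀ φ ψ : ℝ → ℝ, AsymPLap.IsPrincipal p φ → AsymPLap.IsPrincipal p ψ →
        ∀ᵐ t ∂(volume.restrict (Ioo (0 : ℝ) 1)), φ t = ψ t) ∧
    ∀ φ : ℝ → ℝ, AsymPLap.IsPrincipal p φ → ∀ k : ℕ, 1 ≤ k → ∀ u : ℝ → ℝ,
      (AsymPLap.IsEigenfunction p a b L
          (((k : ℝ) * (a + b) / 2) ^ p * AsymPLap.lambda1 p L) u ↔
        ∃ c : ℝ, 0 < c ∧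
          ((∀ᵐ t ∂(volume.restrict (Ioo 0 L)),
              u t = c * AsymPLap.phiPer a b φ ((k : ℝ) * t / L)) ∨
            (∀ᵐ t ∂(volume.restrict (Ioo 0 L)),
              u t = c * AsymPLap.phiPer a b φ ((k : ℝ) * t / L - 1)))) := by
  obtain ⟨σ, hσ⟩ := AsymPLap.exists_isQuarterSine hp
  have hspec := AsymPLap.dirichletSpectrum_eq hp ha hb hL
  refine ⟨⟨?_, hspec⟩, ⟨⟨_, (AsymPLap.isPrincipal_iff hσ hp).2
    (Filter.Eventually.of_forall fun _ => rfl)⟩, fun φ ψ hφ hψ => ?_⟩, fun φ hφ k hk u => ?_⟩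
  · have e : ∀ k : ℕ, ((a + b) / 2) ^ p * (((k : ℝ) * (1 + 1) / 2) ^ p * AsymPLap.lambda1 p L)
        = ((k : ℝ) * (a + b) / 2) ^ p * AsymPLap.lambda1 p L := by
      intro k
      rw [← mul_assoc, ← Real.mul_rpow (by positivity) (by positivity)]
      congr 2
      ring
    rw [hspec, AsymPLap.pSpectrum, AsymPLap.dirichletSpectrum_eq hp one_pos one_pos hL]
    ext lam
    constructor
    · rintro ⟨k, hk, rfl⟩
      exact ⟨_, ⟨k, hk, rfl⟩, e k⟩
    · rintro ⟨_, ⟨k, hk, rfl⟩, rfl⟩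
      exact ⟨k, hk, e k⟩
  · filter_upwards [(AsymPLap.isPrincipal_iff hσ hp).1 hφ,
      (AsymPLap.isPrincipal_iff hσ hp).1 hψ] with t h1 h2
    rw [h1, h2]
  -- Passing from the bump to `φ` multiplies the wave by the positive constant `c₀`, which is
  -- absorbed into `c`.
  · set c₀ := (AsymPLap.lpNormInterval p 1 (AsymPLap.bump σ)).toReal⁻¹ with hc₀
    have hc₀0 : 0 < c₀ := inv_pos.2 (ENNReal.toReal_pos (AsymPLap.lpNorm_bump_ne_zero hσ hp)
      (AsymPLap.lpNorm_bump_ne_top hσ))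
    have hφ' := (AsymPLap.isPrincipal_iff hσ hp).1 hφ
    rw [ae_restrict_iff' measurableSet_Ioo] at hφ'
    have hper := AsymPLap.phiPer_ae_eq ha hb hφ'
    have hk0 : (k : ℝ) / L ≠ 0 := by positivity
    have key : ∀ s : ℝ, ∀ᵐ t ∂(volume.restrict (Ioo 0 L)),
        AsymPLap.phiPer a b φ (k * t / L + s) = c₀ * AsymPLap.wave a b σ (k * t / L + s) := by
      intro s
      refine ae_restrict_of_ae ?_
      have := AsymPLap.ae_comp_affine hper hk0 s
      rw [← hc₀] at this
      simpa only [div_mul_eq_mul_div, AsymPLap.wave] using this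
    have k1 := key 0
    have k2 := key (-1)
    simp only [add_zero, ← sub_eq_add_neg] at k1 k2
    rw [AsymPLap.isEigenfunction_mul_lambda1_iff hσ hp ha hb hL hk]
    constructor
    · rintro ⟨c, hc, h⟩
      refine ⟨c / c₀, by positivity, h.imp (fun h => ?_) fun h => ?_⟩
      · filter_upwards [h, k1] with t e1 e2
        rw [e1, e2]
        field_simp
      · filter_upwards [h, k2] with t e1 e2
        rw [e1, e2]
        field_simp
    · rintro ⟨c, hc, h⟩
      refine ⟨c * c₀, by positivity, h.imp (fun h => ?_) fun h => ?_⟩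
      · filter_upwards [h, k1] with t e1 e2
        rw [e1, e2, mul_assoc]
      · filter_upwards [h, k2] with t e1 e2
        rw [e1, e2, mul_assoc]
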